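/- All Hilbert spaces are finite dimensional, a state is a positive semidefinite operator of trace one, a channel is a completely positive trace-preserving linear map, and $T_X$ denotes the transpose on system $X$ in a fixed orthonormal basis. For channels $\mathcal N,\mathcal M$ from $C$ to $D$ put $$\|\mathcal N-\mathcal M\|_\diamond=\sup_{\sigma_{RC}}\|\mathcal N(\sigma_{RC})-\mathcal M(\sigma_{RC})\|_1,\qquad F(\mathcal N,\mathcal M)=\inf_{\sigma_{RC}}F(\mathcal N(\sigma_{RC}),\mathcal M(\sigma_{RC})),$$ over all states $\sigma_{RC}$ with $R$ an arbitrary finite-dimensional reference system (on which the channels act trivially), where $\|X\|_1=\operatorname{Tr}\sqrt{X^\dagger X}$ and $F(\omega,\tau)=\|\sqrt\omega\sqrt\tau\|_1^2$. A channel $\mathcal P_{AB\hat A\hat B\to A'B'}$ is C-PPT-P if $T_{B'}\circ\mathcal P\circ T_{B\hat B}$ is completely positive. For a channel $\mathcal N_{AB\to A'B'}$ and a state $\rho_{\hat A\hat B}$ let $$e_{\mathrm{PPT}}(\mathcal N,\rho)=\inf_{\mathcal P}\tfrac12\|\mathcal N-\widetilde{\mathcal N}_{\mathcal P}\|_\diamond,\qquad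 e^F_{\mathrm{PPT}}(\mathcal N,\rho)=\inf_{\mathcal P}\,[1-F(\mathcal N,\widetilde{\mathcal N}_{\mathcal P})],\qquad \widetilde{\mathcal N}_{\mathcal P}(\omega_{AB})=\mathcal P(\omega_{AB}\otimes\rho_{\hat A\hat B}),$$ the infima being over all C-PPT-P channels $\mathcal P_{AB\hat A\hat B\to A'B'}$. Let $\mathcal S^d(\omega)=F\omega F^\dagger$ with $F=\sum_{i,j}|i\rangle\langle j|\otimes|j\rangle\langle i|$ be the swap channel on two $d$-dimensional systems, $d\ge1$, with Choi operator $\Gamma^{\mathcal S^d}_{ABA'B'}$. **Proposition.** For every state $\rho_{\hat A\hat B}$ on finite-dimensional systems $\hat A,\hat B$, $$e^F_{\mathrm{PPT}}(\mathcal S^d,\rho)=e_{\mathrm{PPT}}(\mathcal S^d,\rho),$$ and this common value equals $1-[\sup\lambda]^2$, the supremum being over real $\lambda\ge0$, operators $P_{AB\hat A\hat BA'B'}\ge0$ and arbitrary operators $Q_{ABA'B'}$ subject to $\lambda I_{AB}\le\operatorname{Re}[\operatorname{Tr}_{A'B'}Q]$ (where $\operatorname{Re}[X]=(X+X^\dagger)/2$),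 $T_{B\hat BB'}(P)\ge0$, $\operatorname{Tr}_{A'B'}[P]=I_{AB\hat A\hat B}$ and $$\begin{bmatrix}\Gamma^{\mathcal S^d}&Q^\dagger\\Q&\operatorname{Tr}_{\hat A\hat B}[T_{\hat A\hat B}(\rho_{\hat A\hat B})P]\end{bmatrix}\ge0.$$ If moreover $d\ge2$, it also equals the reduced semidefinite program $$1-\sup_{K,L,M,N\ge0}\operatorname{Tr}[\rho_{\hat A\hat B}K],$$ over operators $K,L,M,N$ on $\hat A\hat B$ subject to $K+L+M+N=I$ and $$T_{\hat B}\Big(K+\tfrac{L}{d+1}+\tfrac{M}{d+1}+\tfrac{N}{(d+1)^2}\Big)\ge0,\qquad \tfrac1{d-1}T_{\hat B}\Big(L+\tfrac{N}{d+1}\Big)\ge T_{\hat B}\Big(K+\tfrac{M}{d+1}\Big),$$ $$\tfrac1{d-1}T_{\hat B}\Big(M+\tfrac{N}{d+1}\Big)\ge T_{\hat B}\Big(K+\tfrac{L}{d+1}\Big),\qquad T_{\hat B}\Big(K+\tfrac{N}{(d-1)^2}\Big)\ge\tfrac1{d-1}T_{\hat B}(L+M).$$ -/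

import Mathlib

open scoped Matrix MatrixOrder ComplexOrder Kronecker

noncomputable section

namespace BQT

/-- Linear maps from operators on `ℂ^m` to operators on `ℂ^n`. -/
abbrev Superop (m n : Type*) := Matrix m m ℂ →ₗ[ℂ] Matrix n n ℂ

section Basic

variable {m n k : Type*}

/-- Quantum states: positive semidefinite operators of trace one. -/
def IsState [Fintype m] (ρ : Matrix m m ℂ) : Prop := ρ.PosSemidef ∧ ρ.trace = 1

/-- The action `(id_R ⊗ N)(X)` of `N` on the second tensor factor, where `R = ℂ^k`. -/
def ampliate (N : Superop m n) (X : Matrix (k × m) (k × m) ℂ) : Matrix (k × n) (k × n) ℂ :=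
  Matrix.of fun p q => N (Matrix.of fun i j => X (p.1, i) (q.1, j)) p.2 q.2

/-- Complete positivity: `id_R ⊗ N` preserves positive semidefiniteness for every
finite-dimensional reference system `R`. -/
def IsCP (N : Superop m n) : Prop :=
  ∀ (r : ℕ) (X : Matrix (Fin r × m) (Fin r × m) ℂ), X.PosSemidef → (ampliate N X).PosSemidef

/-- Quantum channels: completely positive trace-preserving linear maps. -/
def IsChannel [Fintype m] [Fintype n] (N : Superop m n) : Prop :=
  IsCP N ∧ ∀ X : Matrix m m ℂ, (N X).trace = X.trace

/-- The trace norm `‖X‖₁ = Tr |X|`, where `|X| = √(X† X)`. -/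
def traceNorm [Fintype n] [DecidableEq n] (X : Matrix n n ℂ) : ℝ :=
  (CFC.sqrt (Xᴴ * X)).trace.re

/-- The fidelity `F(ω, τ) = ‖√ω √τ‖₁²`. -/
def fidelity [Fintype n] [DecidableEq n] (ω τ : Matrix n n ℂ) : ℝ :=
  traceNorm (CFC.sqrt ω * CFC.sqrt τ) ^ 2

/-- The diamond distance of two channels: the supremum of the trace distance of the outputs over
all input states shared with a finite-dimensional reference system. -/
def diamondDist [Fintype m] [Fintype n] [DecidableEq n] (N M : Superop m n) : ℝ :=
  sSup {x : ℝ | ∃ (r : ℕ) (σ : Matrix (Fin r × m) (Fin r × m) ℂ),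
    IsState σ ∧ x = traceNorm (ampliate N σ - ampliate M σ)}

/-- The channel fidelity: the infimum of the fidelity of the outputs over all input states shared
with a finite-dimensional reference system. -/
def channelFidelity [Fintype m] [Fintype n] [DecidableEq n] (N M : Superop m n) : ℝ :=
  sInf {x : ℝ | ∃ (r : ℕ) (σ : Matrix (Fin r × m) (Fin r × m) ℂ),
    IsState σ ∧ x = fidelity (ampliate N σ) (ampliate M σ)}

/-- The unnormalized maximally entangled operator `|Γ⟩⟨Γ|`, with `|Γ⟩ = ∑ i, |i⟩|i⟩`. -/
def maxEnt (m : Type*) [DecidableEq m] : Matrix (m × m) (m × m) ℂ :=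
  Matrix.of fun p q => if p.1 = p.2 ∧ q.1 = q.2 then 1 else 0

/-- The Choi operator `(id_R ⊗ N)(|Γ⟩⟨Γ|)`, with `R` isomorphic to the input system. -/
def choi [DecidableEq m] (N : Superop m n) : Matrix (m × n) (m × n) ℂ :=
  ampliate N (maxEnt m)

/-- The partial trace over the second tensor factor. -/
def traceSnd [Fintype n] (X : Matrix (m × n) (m × n) ℂ) : Matrix m m ℂ :=
  Matrix.of fun i j => ∑ k, X (i, k) (j, k)

/-- The partial transpose on the second tensor factor, `T_B` on the bipartite system `AB`. -/
def transposeSnd : Superop (m × n) (m × n) where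
  toFun X := Matrix.of fun p q => X (p.1, q.2) (q.1, p.2)
  map_add' _ _ := rfl
  map_smul' _ _ := rfl

/-- The Hermitian part `Re[X] = (X + X†) / 2`. -/
def hermPart (X : Matrix m m ℂ) : Matrix m m ℂ := (1 / 2 : ℝ) • (X + Xᴴ)

end Basic

section Simulation

/- Alice holds the input `A`, the output `A'` (here `A₂`) and the share `Â` (here `E`) of the
resource; Bob holds `B`, `B'` (here `B₂`) and `B̂` (here `G`). -/
variable {A B A₂ B₂ E G : Type*}

/-- The transpose `T_{B B̂}` on the systems of Bob among `A B Â B̂`. -/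
def transposeBob : Superop ((A × B) × (E × G)) ((A × B) × (E × G)) where
  toFun X := Matrix.of fun p q =>
    X ((p.1.1, q.1.2), (p.2.1, q.2.2)) ((q.1.1, p.1.2), (q.2.1, p.2.2))
  map_add' _ _ := rfl
  map_smul' _ _ := rfl

/-- The transpose `T_{B B̂ B'}` on the systems of Bob among `A B Â B̂ A' B'`. -/
def transposeBobChoi (X : Matrix (((A × B) × (E × G)) × (A₂ × B₂))
      (((A × B) × (E × G)) × (A₂ × B₂)) ℂ) :
    Matrix (((A × B) × (E × G)) × (A₂ × B₂)) (((A × B) × (E × G)) × (A₂ × B₂)) ℂ :=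
  Matrix.of fun p q =>
    X (((p.1.1.1, q.1.1.2), (p.1.2.1, q.1.2.2)), (p.2.1, q.2.2))
      (((q.1.1.1, p.1.1.2), (q.1.2.1, p.1.2.2)), (q.2.1, p.2.2))

/-- The simulation `ω ↦ P (ω ⊗ ρ)` obtained from the resource state `ρ` on `Â B̂`. -/
def simulate (P : Superop ((A × B) × (E × G)) (A₂ × B₂)) (ρ : Matrix (E × G) (E × G) ℂ) :
    Superop (A × B) (A₂ × B₂) where
  toFun ω := P (ω ⊗ₖ ρ)
  map_add' X Y := by rw [Matrix.add_kronecker, map_add]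
  map_smul' c X := by rw [Matrix.smul_kronecker, map_smul]; rfl

variable [Fintype A] [Fintype B] [Fintype A₂] [Fintype B₂] [Fintype E] [Fintype G]

/-- C-PPT-P channels `P` from `A B Â B̂` to `A' B'`: quantum channels such that
`T_{B'} ∘ P ∘ T_{B B̂}` is completely positive. -/
def IsCPPTP (P : Superop ((A × B) × (E × G)) (A₂ × B₂)) : Prop :=
  IsChannel P ∧ IsCP (transposeSnd ∘ₗ P ∘ₗ transposeBob)

/-- The C-PPT-P simulation error of `N` with resource `ρ` in normalized diamond distance. -/
def errPPT [DecidableEq A₂] [DecidableEq B₂] (N : Superop (A × B) (A₂ × B₂))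
    (ρ : Matrix (E × G) (E × G) ℂ) : ℝ :=
  sInf {x : ℝ | ∃ P : Superop ((A × B) × (E × G)) (A₂ × B₂),
    IsCPPTP P ∧ x = 1 / 2 * diamondDist N (simulate P ρ)}

/-- The C-PPT-P simulation error of `N` with resource `ρ` in channel infidelity. -/
def errPPTInfid [DecidableEq A₂] [DecidableEq B₂] (N : Superop (A × B) (A₂ × B₂))
    (ρ : Matrix (E × G) (E × G) ℂ) : ℝ :=
  sInf {x : ℝ | ∃ P : Superop ((A × B) × (E × G)) (A₂ × B₂),
    IsCPPTP P ∧ x = 1 - channelFidelity N (simulate P ρ)}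

/-- `Tr_{Â B̂}[T_{Â B̂}(ρ) P]`, an operator on `A B A' B'`. -/
def contractResource (ρ : Matrix (E × G) (E × G) ℂ)
    (P : Matrix (((A × B) × (E × G)) × (A₂ × B₂)) (((A × B) × (E × G)) × (A₂ × B₂)) ℂ) :
    Matrix ((A × B) × (A₂ × B₂)) ((A × B) × (A₂ × B₂)) ℂ :=
  Matrix.of fun p q => ∑ h, ∑ l, ρᵀ h l * P ((p.1, l), p.2) ((q.1, h), q.2)

/-- The semidefinite program for the C-PPT-P simulation error in channel infidelity:
`1 - (sup λ)²` over `λ ≥ 0`, `P ≥ 0` on `A B Â B̂ A' B'` and arbitrary `Q` on `A B A' B'`, subject to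
`λ I ≤ Re[Tr_{A' B'} Q]`, `T_{B B̂ B'}(P) ≥ 0`, `Tr_{A' B'} P = I` and positivity of the block
matrix with blocks `Γ^N`, `Q†`, `Q`, `Tr_{Â B̂}[T_{Â B̂}(ρ) P]`. -/
def infidSDP [DecidableEq A] [DecidableEq B] [DecidableEq E] [DecidableEq G]
    (N : Superop (A × B) (A₂ × B₂)) (ρ : Matrix (E × G) (E × G) ℂ) : ℝ :=
  1 - sSup {l : ℝ | 0 ≤ l ∧
    ∃ (P : Matrix (((A × B) × (E × G)) × (A₂ × B₂)) (((A × B) × (E × G)) × (A₂ × B₂)) ℂ)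
      (Q : Matrix ((A × B) × (A₂ × B₂)) ((A × B) × (A₂ × B₂)) ℂ),
      0 ≤ P ∧
      l • (1 : Matrix (A × B) (A × B) ℂ) ≤ hermPart (traceSnd Q) ∧
      0 ≤ transposeBobChoi P ∧
      traceSnd P = 1 ∧
      0 ≤ Matrix.fromBlocks (choi N) Qᴴ Q (contractResource ρ P)} ^ 2

end Simulation

section Swap

/-- The unitary swap operator `F = ∑ i j, |i⟩⟨j| ⊗ |j⟩⟨i|` on two `d`-dimensional systems. -/
def swapOp (d : ℕ) : Matrix (Fin d × Fin d) (Fin d × Fin d) ℂ :=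
  ∑ i, ∑ j, Matrix.single i j 1 ⊗ₖ Matrix.single j i 1

/-- The swap channel `ω ↦ F ω F†`. -/
def swapChannel (d : ℕ) : Superop (Fin d × Fin d) (Fin d × Fin d) where
  toFun ω := swapOp d * ω * (swapOp d)ᴴ
  map_add' X Y := by rw [Matrix.mul_add, Matrix.add_mul]
  map_smul' c X := by simp

variable {E G : Type*} [Fintype E] [Fintype G] [DecidableEq E] [DecidableEq G]

/-- The constraints of the reduced semidefinite program for the swap channel. -/
def SwapFeasible (d : ℕ) (K L M N : Matrix (E × G) (E × G) ℂ) : Prop :=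
  0 ≤ K ∧ 0 ≤ L ∧ 0 ≤ M ∧ 0 ≤ N ∧
  0 ≤ transposeSnd (K + (1 / (d + 1) : ℝ) • L + (1 / (d + 1) : ℝ) • M +
    (1 / (d + 1) ^ 2 : ℝ) • N) ∧
  transposeSnd (K + (1 / (d + 1) : ℝ) • M) ≤
    (1 / (d - 1) : ℝ) • transposeSnd (L + (1 / (d + 1) : ℝ) • N) ∧
  transposeSnd (K + (1 / (d + 1) : ℝ) • L) ≤
    (1 / (d - 1) : ℝ) • transposeSnd (M + (1 / (d + 1) : ℝ) • N) ∧
  (1 / (d - 1) : ℝ) • transposeSnd (L + M) ≤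
    transposeSnd (K + (1 / (d - 1) ^ 2 : ℝ) • N) ∧
  K + L + M + N = 1

/-- The reduced semidefinite program `1 - sup Tr[ρ K]` for the swap channel. -/
def swapReducedSDP (d : ℕ) (ρ : Matrix (E × G) (E × G) ℂ) : ℝ :=
  1 - sSup {x : ℝ | ∃ K L M N : Matrix (E × G) (E × G) ℂ,
    SwapFeasible d K L M N ∧ x = (ρ * K).trace.re}

end Swap

end BQT

end

/-!
The Choi operator of the swap channel `N` is a pure state up to normalization: writing
`Γ = |Γ⟩⟨Γ|`, it is `Γ` on `A B'` tensored with `Γ` on `B A'`. Hence the overlap of the normalized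
Choi operators of `N` and of its simulation `M` by `P`, the entanglement fidelity, is an upper bound
on the channel fidelity of `N` and `M`, on one minus half their diamond distance, and on `λ ^ 2` for
every `λ` feasible for `P` in the first semidefinite program. Conversely, if `M - f • N` is
completely positive, then `f` is a lower bound on the first two quantities and `√f` is feasible. So
both errors and the program equal one minus the supremum of the entanglement fidelities, once every
simulation can be replaced by one that dominates `f • N`, where `f` is the entanglement fidelity of
the simulation it replaces.

Twirling by `U ⊗ V` on the inputs and `V ⊗ U` on the outputs would provide the replacement. No
averaging over unitaries is needed, because the twirled Choi operator is a combination of the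
products of `Γ` and `d I - Γ` on `A B'` and `B A'`. Its coefficients are operators on the resource,
up to normalization the pairings `K, L, M, N` of the Choi operator of `P` with these products.
Conversely, measuring the resource with `K, L, M, N` and applying the channel that belongs to the
outcome dominates `Tr[ρ K] • N`. Since the partial transpose of `Γ` is the swap operator `F`, whose
eigenvalues are `±1`, the PPT condition amounts to four inequalities, one for each pair of factors
`1 ± F`: these are the constraints of the reduced program.
-/

namespace BQT

section TraceNorm

variable {n : Type*} [Fintype n]

theorem re_trace_nonneg {A : Matrix n n ℂ} (hA : A.PosSemidef) : 0 ≤ A.trace.re :=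
  (Complex.le_def.1 hA.trace_nonneg).1

open scoped Matrix.Norms.L2Operator in
theorem trace_mul_nonneg {A B : Matrix n n ℂ} (hA : A.PosSemidef) (hB : B.PosSemidef) :
    0 ≤ (A * B).trace := by
  classical
  obtain ⟨C, rfl⟩ := CStarAlgebra.nonneg_iff_eq_star_mul_self.1 hA.nonneg
  rw [Matrix.mul_assoc, Matrix.trace_mul_comm]
  exact (hB.mul_mul_conjTranspose_same C).trace_nonneg

theorem re_trace_mul_mono {A B C : Matrix n n ℂ} (hA : A.PosSemidef) (hBC : B ≤ C) :
    (A * B).trace.re ≤ (A * C).trace.re := by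
  simpa only [Matrix.mul_sub, Matrix.trace_sub, Complex.zero_re, Complex.sub_re, sub_nonneg]
    using (Complex.le_def.1 (trace_mul_nonneg hA (Matrix.le_iff.1 hBC))).1

theorem re_trace_conjTranspose_mul {A : Matrix n n ℂ} (hA : A.IsHermitian) (W : Matrix n n ℂ) :
    (Wᴴ * A).trace.re = (W * A).trace.re := by
  rw [Matrix.trace_mul_comm, ← hA.eq, ← Matrix.conjTranspose_mul, Matrix.trace_conjTranspose, hA.eq]
  exact Complex.conj_re _

variable [DecidableEq n]

theorem abs_re_trace_mul_le {W A : Matrix n n ℂ} (hW : Wᴴ * W ≤ 1) (hA : A.PosSemidef) :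
    |(W * A).trace.re| ≤ A.trace.re := by
  have hWA : (W * A * Wᴴ).trace.re ≤ A.trace.re := by
    rw [Matrix.trace_mul_cycle, Matrix.trace_mul_comm]
    simpa only [Matrix.mul_one] using re_trace_mul_mono hA hW
  have hadj : (A * Wᴴ).trace.re = (W * A).trace.re := by
    rw [Matrix.trace_mul_comm, re_trace_conjTranspose_mul hA.isHermitian]
  have hsub := re_trace_nonneg (hA.mul_mul_conjTranspose_same (1 - W))
  have hadd := re_trace_nonneg (hA.mul_mul_conjTranspose_same (1 + W))
  simp only [Matrix.conjTranspose_sub, Matrix.conjTranspose_add, Matrix.conjTranspose_one,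
    sub_mul, add_mul, mul_sub, mul_add, one_mul, mul_one, Matrix.trace_sub, Matrix.trace_add,
    Complex.sub_re, Complex.add_re, hadj] at hsub hadd
  exact abs_le.2 ⟨by linarith, by linarith⟩

omit [DecidableEq n] in
theorem exists_isHermitian_mul_mul_self {S : Matrix n n ℂ} (hS : S.IsHermitian) :
    ∃ R : Matrix n n ℂ, R.IsHermitian ∧ Commute R S ∧ S * R * S = S := by
  classical
  have hcont (f : ℝ → ℝ) : ContinuousOn f (spectrum ℝ S) :=
    Matrix.finite_real_spectrum.continuousOn f
  have hid : cfc (id : ℝ → ℝ) S = S := cfc_id ℝ S (ha := hS.isSelfAdjoint)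
  refine ⟨cfc (fun x : ℝ => x⁻¹) S, IsSelfAdjoint.cfc, ?_, ?_⟩
  · simpa only [hid] using cfc_commute_cfc (fun x : ℝ => x⁻¹) id S
  · calc S * cfc (fun x : ℝ => x⁻¹) S * S
        = cfc (fun x : ℝ => id x * x⁻¹ * id x) S := by
          rw [cfc_mul _ _ S (hcont _) (hcont _), cfc_mul _ _ S (hcont _) (hcont _), hid]
      _ = S := by simp only [id, mul_inv_mul_cancel, cfc_id' ℝ S (ha := hS.isSelfAdjoint)]

theorem exists_polar_decomposition (X : Matrix n n ℂ) :
    ∃ W : Matrix n n ℂ, Wᴴ * W ≤ 1 ∧ W * CFC.abs X = X ∧ Wᴴ * X = CFC.abs X := by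
  have hS : (CFC.abs X).IsHermitian :=
    (Matrix.nonneg_iff_posSemidef.1 (CFC.abs_nonneg X)).isHermitian
  have hSS : Xᴴ * X = CFC.abs X * CFC.abs X := (CFC.abs_mul_abs X).symm
  generalize CFC.abs X = S at hS hSS ⊢
  obtain ⟨R, hR, hRS, hSRS⟩ := exists_isHermitian_mul_mul_self hS
  have hRSH : (R * S)ᴴ = R * S := by rw [Matrix.conjTranspose_mul, hR, hS, hRS.eq]
  have hW : (X * R)ᴴ * X = S := by
    rw [Matrix.conjTranspose_mul, hR, Matrix.mul_assoc, hSS, ← Matrix.mul_assoc, hRS.eq, hSRS]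
  refine ⟨X * R, ?_, ?_, hW⟩
  · have hproj : 1 - (X * R)ᴴ * (X * R) = (1 - R * S)ᴴ * (1 - R * S) := by
      rw [← Matrix.mul_assoc, hW, ← hRS.eq, Matrix.conjTranspose_sub, Matrix.conjTranspose_one,
        hRSH, sub_mul, one_mul, mul_sub, mul_one, Matrix.mul_assoc R, ← Matrix.mul_assoc S, hSRS,
        sub_self, sub_zero]
    rw [Matrix.le_iff, hproj]
    exact Matrix.posSemidef_conjTranspose_mul_self _
  · have hker : (X - X * R * S)ᴴ * (X - X * R * S) = 0 := by
      have hXRS : Xᴴ * (X - X * R * S) = 0 := by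
        rw [Matrix.mul_sub, Matrix.mul_assoc X, ← Matrix.mul_assoc Xᴴ, hSS, Matrix.mul_assoc S,
          ← Matrix.mul_assoc S R, hSRS, sub_self]
      rw [Matrix.conjTranspose_sub, Matrix.mul_assoc X, Matrix.conjTranspose_mul, sub_mul,
        Matrix.mul_assoc, ← Matrix.mul_assoc X, hXRS, Matrix.mul_zero, sub_self]
    exact (sub_eq_zero.1 (Matrix.conjTranspose_mul_self_eq_zero.1 hker)).symm

theorem re_trace_mul_le_traceNorm {V : Matrix n n ℂ} (hV : Vᴴ * V ≤ 1) (X : Matrix n n ℂ) :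
    (V * X).trace.re ≤ traceNorm X := by
  obtain ⟨W, hW, hWX, -⟩ := exists_polar_decomposition X
  have hVW : (V * W)ᴴ * (V * W) ≤ 1 := by
    refine le_trans ?_ hW
    have h := (Matrix.le_iff.1 hV).conjTranspose_mul_mul_same W
    rw [Matrix.mul_sub, Matrix.sub_mul, Matrix.mul_one] at h
    rw [Matrix.le_iff, Matrix.conjTranspose_mul]
    simpa only [Matrix.mul_assoc] using h
  have habs : (CFC.abs X).PosSemidef := Matrix.nonneg_iff_posSemidef.1 (CFC.abs_nonneg X)
  calc (V * X).trace.re = (V * W * CFC.abs X).trace.re := by rw [Matrix.mul_assoc, hWX]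
    _ ≤ traceNorm X := (le_abs_self _).trans (abs_re_trace_mul_le hVW habs)

theorem re_trace_le_traceNorm (X : Matrix n n ℂ) : X.trace.re ≤ traceNorm X := by
  simpa using re_trace_mul_le_traceNorm (V := 1) (by simp) X

theorem traceNorm_sub_le {A B : Matrix n n ℂ} (hA : A.PosSemidef) (hB : B.PosSemidef) :
    traceNorm (A - B) ≤ A.trace.re + B.trace.re := by
  obtain ⟨W, hW, -, hWX⟩ := exists_polar_decomposition (A - B)
  have hadj {C : Matrix n n ℂ} (hC : C.PosSemidef) := re_trace_conjTranspose_mul hC.isHermitian W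
  calc traceNorm (A - B) = (W * A).trace.re - (W * B).trace.re := by
        rw [← hadj hA, ← hadj hB, ← Complex.sub_re, ← Matrix.trace_sub, ← Matrix.mul_sub, hWX]
        rfl
    _ ≤ A.trace.re + B.trace.re := by
        linarith [(abs_le.1 (abs_re_trace_mul_le hW hA)).2,
          (abs_le.1 (abs_re_trace_mul_le hW hB)).1]

end TraceNorm

section Fidelity

variable {n : Type*}

/-- Unnormalized pure states: the operators of the form `|γ⟩⟨γ|`. -/
def IsPure (J : Matrix n n ℂ) : Prop := ∃ γ : n → ℂ, J = Matrix.vecMulVec γ (star γ)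

theorem IsPure.submatrix {J : Matrix n n ℂ} (hJ : IsPure J) {m : Type*} (f : m → n) :
    IsPure (J.submatrix f f) := by
  obtain ⟨γ, rfl⟩ := hJ
  exact ⟨γ ∘ f, rfl⟩

theorem IsPure.smul {J : Matrix n n ℂ} (hJ : IsPure J) {c : ℝ} (hc : 0 ≤ c) :
    IsPure (c • J) := by
  obtain ⟨γ, rfl⟩ := hJ
  refine ⟨√c • γ, ?_⟩
  rw [star_smul, Matrix.smul_vecMulVec, Matrix.vecMulVec_smul, smul_smul, star_trivial √c,
    Real.mul_self_sqrt hc]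

theorem IsPure.posSemidef [Finite n] {J : Matrix n n ℂ} (hJ : IsPure J) : J.PosSemidef := by
  have := Fintype.ofFinite n
  obtain ⟨γ, rfl⟩ := hJ
  exact Matrix.posSemidef_vecMulVec_self_star γ

variable [Fintype n]

theorem IsPure.mul_mul_self {J : Matrix n n ℂ} (hJ : IsPure J) (A : Matrix n n ℂ) :
    J * A * J = (J * A).trace • J := by
  obtain ⟨γ, rfl⟩ := hJ
  rw [Matrix.vecMulVec_mul, Matrix.vecMulVec_mul_vecMulVec, Matrix.trace_vecMulVec,
    dotProduct_comm, Matrix.vecMulVec_smul]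

theorem IsPure.mul_self {J : Matrix n n ℂ} (hJ : IsPure J) : J * J = J.trace • J := by
  classical
  simpa only [Matrix.mul_one] using hJ.mul_mul_self 1

open scoped Classical in
theorem sqrt_posSemidef (A : Matrix n n ℂ) : (CFC.sqrt A).PosSemidef :=
  Matrix.nonneg_iff_posSemidef.1 (CFC.sqrt_nonneg A)

open scoped Classical in
theorem sqrt_mul_sqrt {A : Matrix n n ℂ} (hA : A.PosSemidef) : CFC.sqrt A * CFC.sqrt A = A :=
  CFC.sqrt_mul_sqrt_self A hA.nonneg

open scoped Classical in
theorem sqrt_eq_smul_of_mul_self {Z : Matrix n n ℂ} (hZ : Z.PosSemidef) {t : ℝ} (ht : 0 ≤ t)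
    (h : Z * Z = t • Z) : CFC.sqrt Z = (√t)⁻¹ • Z := by
  refine CFC.sqrt_unique ?_ (hZ.smul (inv_nonneg.2 (Real.sqrt_nonneg t))).nonneg
  rw [smul_mul_smul_comm, h, smul_smul, ← mul_inv, Real.mul_self_sqrt ht]
  rcases eq_or_ne t 0 with rfl | ht0
  · have hZ0 : Zᴴ * Z = 0 := by rw [hZ.isHermitian.eq, h, zero_smul]
    rw [Matrix.conjTranspose_mul_self_eq_zero.1 hZ0, smul_zero]
  · rw [inv_mul_cancel₀ ht0, one_smul]

variable [DecidableEq n]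

open scoped Matrix.Norms.L2Operator in
theorem le_fidelity_of_smul_le {c : ℝ} (hc : 0 ≤ c) {ω τ : Matrix n n ℂ} (hω : IsState ω)
    (h : c • ω ≤ τ) : c ≤ fidelity ω τ := by
  have hsqrt : CFC.sqrt (c • ω) = √c • CFC.sqrt ω := by
    refine CFC.sqrt_unique ?_ ((sqrt_posSemidef ω).smul (Real.sqrt_nonneg c)).nonneg
    rw [smul_mul_smul_comm, Real.mul_self_sqrt hc, sqrt_mul_sqrt hω.1]
  have hle : √c ≤ traceNorm (CFC.sqrt ω * CFC.sqrt τ) := by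
    calc √c = (CFC.sqrt ω * √c • CFC.sqrt ω).trace.re := by
          rw [Matrix.mul_smul, sqrt_mul_sqrt hω.1, Matrix.trace_smul, hω.2]
          simp
      _ ≤ (CFC.sqrt ω * CFC.sqrt τ).trace.re :=
          re_trace_mul_mono (sqrt_posSemidef ω) (hsqrt ▸ CFC.sqrt_le_sqrt _ _ h)
      _ ≤ _ := re_trace_le_traceNorm _
  exact (Real.sqrt_le_left (Real.sqrt_nonneg c |>.trans hle)).1 hle

theorem fidelity_of_isPure {ω τ : Matrix n n ℂ} (hω : IsState ω) (hpure : IsPure ω)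
    (hτ : τ.PosSemidef) : fidelity ω τ = (ω * τ).trace.re := by
  have hωω : ω * ω = ω := by rw [hpure.mul_self, hω.2, one_smul]
  set t := (ω * τ).trace.re
  have htrace : (ω * τ).trace = (t : ℂ) := Complex.eq_re_of_ofReal_le (trace_mul_nonneg hω.1 hτ)
  have ht : 0 ≤ t := (Complex.le_def.1 (trace_mul_nonneg hω.1 hτ)).1
  set S := CFC.sqrt τ
  have hS : S.PosSemidef := sqrt_posSemidef τ
  have hSS : S * S = τ := sqrt_mul_sqrt hτ
  have hX : (ω * S)ᴴ * (ω * S) = S * ω * S := by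
    rw [Matrix.conjTranspose_mul, hS.isHermitian.eq, hω.1.isHermitian.eq, Matrix.mul_assoc,
      ← Matrix.mul_assoc ω, hωω, Matrix.mul_assoc]
  have hZ : (S * ω * S).PosSemidef := hX ▸ Matrix.posSemidef_conjTranspose_mul_self _
  have hZZ : S * ω * S * (S * ω * S) = t • (S * ω * S) := by
    calc S * ω * S * (S * ω * S) = S * (ω * (S * S) * ω) * S := by simp only [Matrix.mul_assoc]
      _ = t • (S * ω * S) := by
        rw [hSS, hpure.mul_mul_self, htrace, Matrix.mul_smul, Matrix.smul_mul]
        rfl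
  have htraceZ : (S * ω * S).trace = (t : ℂ) := by
    rw [Matrix.trace_mul_cycle, hSS, Matrix.trace_mul_comm, htrace]
  have hnorm : traceNorm (ω * S) = (√t)⁻¹ * t := by
    rw [traceNorm, hX, sqrt_eq_smul_of_mul_self hZ ht hZZ, Matrix.trace_smul, htraceZ]
    simp
  have hsqrt : CFC.sqrt ω = ω := CFC.sqrt_unique hωω hω.1.nonneg
  rw [fidelity, hsqrt, hnorm, inv_mul_eq_div, Real.div_sqrt, Real.sq_sqrt ht]

theorem one_sub_re_trace_mul_le_traceNorm {ω τ : Matrix n n ℂ} (hω : IsState ω) (hpure : IsPure ω)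
    (hτ : τ.trace = 1) : 1 - (ω * τ).trace.re ≤ 1 / 2 * traceNorm (ω - τ) := by
  have hωω : ω * ω = ω := by rw [hpure.mul_self, hω.2, one_smul]
  have hω_herm := hω.1.isHermitian.eq
  -- The reflection `2 ω - 1` is the unitary to test the trace norm of `ω - τ` with.
  have hV : ((2 : ℝ) • ω - 1)ᴴ * ((2 : ℝ) • ω - 1) ≤ 1 := by
    refine le_of_eq ?_
    rw [Matrix.conjTranspose_sub, Matrix.conjTranspose_smul, hω_herm, Matrix.conjTranspose_one,
      star_trivial, sub_mul, mul_sub, smul_mul_smul_comm, hωω, mul_one, one_mul]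
    module
  have h := re_trace_mul_le_traceNorm hV (ω - τ)
  simp only [sub_mul, mul_sub, Matrix.smul_mul, hωω, one_mul, Matrix.trace_sub, Matrix.trace_smul,
    hω.2, hτ, Complex.sub_re, Complex.real_smul, Complex.re_ofReal_mul, Complex.one_re] at h
  linarith

end Fidelity

section Choi

variable {m n k : Type*}

theorem posSemidef_sum_blocks [Finite n] [Fintype m] {Y : Matrix (n × m) (n × m) ℂ}
    (hY : Y.PosSemidef) :
    (Matrix.of fun p q => ∑ i, ∑ j, Y (p, i) (q, j) : Matrix n n ℂ).PosSemidef := by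
  classical
  have := Fintype.ofFinite n
  convert hY.conjTranspose_mul_mul_same
    (Matrix.of fun (x : n × m) (q : n) => if x.1 = q then 1 else 0) using 1
  ext p q
  simp only [Matrix.of_apply, Matrix.mul_apply, Matrix.conjTranspose_apply, apply_ite, star_one,
    star_zero, ite_mul, one_mul, zero_mul, Fintype.sum_prod_type_right, Finset.sum_ite_eq',
    Finset.mem_univ, ↓reduceIte, mul_one, mul_zero]
  exact Finset.sum_comm

variable [Fintype m]

/-- The superoperator with Choi operator `C`. -/
def ofChoi (C : Matrix (m × n) (m × n) ℂ) : Superop m n where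
  toFun X := Matrix.of fun a b => ∑ i, ∑ j, X i j * C (i, a) (j, b)
  map_add' X Y := by
    ext a b
    simp [add_mul, Finset.sum_add_distrib]
  map_smul' c X := by
    ext a b
    simp [Finset.mul_sum, mul_assoc]

theorem ofChoi_apply (C : Matrix (m × n) (m × n) ℂ) (X : Matrix m m ℂ) (a b : n) :
    ofChoi C X a b = ∑ i, ∑ j, X i j * C (i, a) (j, b) := rfl

theorem ampliate_ofChoi_posSemidef [Finite k] [Finite n] {C : Matrix (m × n) (m × n) ℂ}
    (hC : C.PosSemidef) {X : Matrix (k × m) (k × m) ℂ} (hX : X.PosSemidef) :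
    (ampliate (ofChoi C) X).PosSemidef := by
  have h := posSemidef_sum_blocks
    ((hX.kronecker hC).submatrix fun x : (k × n) × m => ((x.1.1, x.2), (x.2, x.1.2)))
  simp only [Matrix.submatrix_apply, Matrix.kronecker_apply] at h
  exact h

theorem ofChoi_posSemidef [Finite n] {C : Matrix (m × n) (m × n) ℂ} (hC : C.PosSemidef)
    {X : Matrix m m ℂ} (hX : X.PosSemidef) : (ofChoi C X).PosSemidef := by
  have h := posSemidef_sum_blocks
    ((hX.kronecker hC).submatrix fun x : n × m => (x.2, (x.2, x.1)))
  simp only [Matrix.submatrix_apply, Matrix.kronecker_apply] at h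
  exact h

omit [Fintype m] in
theorem isPure_maxEnt [DecidableEq m] : IsPure (maxEnt m) := by
  refine ⟨fun p => if p.1 = p.2 then 1 else 0, ?_⟩
  ext p q
  simp only [maxEnt, Matrix.of_apply, Matrix.vecMulVec_apply, Pi.star_apply,
    apply_ite (star : ℂ → ℂ), star_one, star_zero, ite_zero_mul_ite_zero, mul_one]

variable [DecidableEq m]

omit [Fintype m] in
theorem choi_apply (N : Superop m n) (p q : m × n) :
    choi N p q = N (Matrix.single p.1 q.1 1) p.2 q.2 := by
  rw [choi, ampliate, Matrix.of_apply]
  congr 2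

theorem choi_ofChoi (C : Matrix (m × n) (m × n) ℂ) : choi (ofChoi C) = C := by
  ext ⟨i, a⟩ ⟨j, b⟩
  rw [choi_apply, ofChoi_apply]
  simp [Matrix.single_apply, ite_and]

theorem ofChoi_choi (N : Superop m n) : ofChoi (choi N) = N := by
  refine LinearMap.ext fun X => Matrix.ext fun a b => ?_
  conv_rhs => rw [Matrix.matrix_eq_sum_single X]
  simp only [ofChoi_apply, choi_apply, map_sum, Matrix.sum_apply]
  refine Finset.sum_congr rfl fun i _ => Finset.sum_congr rfl fun j _ => ?_
  rw [← mul_one (X i j), ← smul_eq_mul (X i j) 1, ← Matrix.smul_single, map_smul, smul_eq_mul,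
    mul_one]
  rfl

omit [Fintype m] in
theorem isCP_iff_choi_posSemidef [Finite m] [Finite n] {N : Superop m n} :
    IsCP N ↔ (choi N).PosSemidef := by
  have := Fintype.ofFinite m
  refine ⟨fun h => ?_, fun h r X hX => ofChoi_choi N ▸ ampliate_ofChoi_posSemidef h hX⟩
  let e := Fintype.equivFin m
  have hreindex := (h _ _ (isPure_maxEnt.posSemidef.submatrix (Prod.map e.symm id))).submatrix
    (Prod.map e id)
  convert hreindex using 1
  ext p q
  simp [choi, ampliate]

theorem trace_preserving_iff [Fintype n] {N : Superop m n} :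
    (∀ X, (N X).trace = X.trace) ↔ traceSnd (choi N) = 1 := by
  constructor
  · intro h
    ext i j
    calc traceSnd (choi N) i j = (N (Matrix.single i j 1)).trace := by
          simp only [traceSnd, Matrix.of_apply, choi_apply, Matrix.trace, Matrix.diag_apply]
      _ = (1 : Matrix m m ℂ) i j := by
          rw [h, Matrix.one_apply]
          split_ifs with hij
          · rw [hij, Matrix.trace_single_eq_same]
          · exact Matrix.trace_single_eq_of_ne i j 1 hij
  · intro h X
    calc (N X).trace = ∑ i, ∑ j, X i j * traceSnd (choi N) i j := by
          conv_lhs => rw [← ofChoi_choi N]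
          simp only [Matrix.trace, Matrix.diag_apply, ofChoi_apply, traceSnd, Matrix.of_apply,
            Finset.mul_sum]
          rw [Finset.sum_comm]
          exact Finset.sum_congr rfl fun i _ => Finset.sum_comm
      _ = X.trace := by simp [h, Matrix.one_apply, Matrix.trace]

end Choi

section Channels

variable {m n k : Type*} [Fintype m] [Fintype n]

theorem isState_ampliate [Fintype k] {N : Superop m n} (hN : IsChannel N)
    {σ : Matrix (k × m) (k × m) ℂ} (hσ : IsState σ) : IsState (ampliate N σ) := by
  classical
  refine ⟨?_, ?_⟩
  · rw [← ofChoi_choi N]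
    exact ampliate_ofChoi_posSemidef (isCP_iff_choi_posSemidef.1 hN.1) hσ.1
  · rw [← hσ.2]
    simp only [Matrix.trace, Fintype.sum_prod_type]
    exact Finset.sum_congr rfl fun i _ => hN.2 (Matrix.of fun a b => σ (i, a) (i, b))

end Channels

section Simulation

variable {A B A₂ B₂ E G : Type*}

theorem choi_partialTranspose [DecidableEq A] [DecidableEq B] [DecidableEq E] [DecidableEq G]
    (P : Superop ((A × B) × (E × G)) (A₂ × B₂)) :
    choi (transposeSnd ∘ₗ P ∘ₗ transposeBob) = transposeBobChoi (choi P) := by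
  ext ⟨⟨⟨a, b⟩, ⟨e, g⟩⟩, ⟨a', b'⟩⟩ ⟨⟨⟨c, d⟩, ⟨f, h⟩⟩, ⟨c', d'⟩⟩
  have hsingle : transposeBob (Matrix.single ((a, b), (e, g)) ((c, d), (f, h)) (1 : ℂ)) =
      Matrix.single ((a, d), (e, h)) ((c, b), (f, g)) 1 := by
    ext ⟨⟨x, y⟩, ⟨z, w⟩⟩ ⟨⟨x', y'⟩, ⟨z', w'⟩⟩
    change Matrix.single ((a, b), (e, g)) ((c, d), (f, h)) (1 : ℂ) ((x, y'), (z, w'))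
      ((x', y), (z', w)) = _
    simp only [Matrix.single_apply, Prod.mk.injEq]
    exact if_congr (by tauto) rfl rfl
  simp only [transposeBobChoi, Matrix.of_apply, choi_apply, LinearMap.comp_apply, hsingle]
  rfl

theorem IsCP.simulate [Finite A] [Finite B] [Finite E] [Finite G]
    {P : Superop ((A × B) × (E × G)) (A₂ × B₂)} (hP : IsCP P) {ρ : Matrix (E × G) (E × G) ℂ}
    (hρ : ρ.PosSemidef) : IsCP (simulate P ρ) := by
  intro r X hX
  exact hP r _ ((hX.kronecker hρ).submatrix
    fun x : Fin r × ((A × B) × (E × G)) => ((x.1, x.2.1), x.2.2))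

variable [Fintype E] [Fintype G]

theorem simulate_ofChoi [Fintype A] [Fintype B]
    (C : Matrix (((A × B) × (E × G)) × (A₂ × B₂)) (((A × B) × (E × G)) × (A₂ × B₂)) ℂ)
    (ρ : Matrix (E × G) (E × G) ℂ) :
    simulate (ofChoi C) ρ = ofChoi (contractResource ρ C) := by
  refine LinearMap.ext fun X => Matrix.ext fun a b => ?_
  change ∑ x, ∑ y, X x.1 y.1 * ρ x.2 y.2 * C (x, a) (y, b) =
    ∑ i, ∑ j, X i j * ∑ h, ∑ l, ρ l h * C ((i, l), a) ((j, h), b)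
  rw [Fintype.sum_prod_type]
  refine Finset.sum_congr rfl fun i _ => ?_
  rw [Finset.sum_comm, Fintype.sum_prod_type]
  simp only [Finset.mul_sum, mul_assoc]

variable [DecidableEq A] [DecidableEq B] [DecidableEq E] [DecidableEq G]

theorem choi_simulate [Finite A] [Finite B] (P : Superop ((A × B) × (E × G)) (A₂ × B₂))
    (ρ : Matrix (E × G) (E × G) ℂ) : choi (simulate P ρ) = contractResource ρ (choi P) := by
  have := Fintype.ofFinite A
  have := Fintype.ofFinite B
  conv_lhs => rw [← ofChoi_choi P, simulate_ofChoi, choi_ofChoi]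

variable [Fintype A] [Fintype B] [Fintype A₂] [Fintype B₂]

theorem isCPPTP_iff {P : Superop ((A × B) × (E × G)) (A₂ × B₂)} :
    IsCPPTP P ↔ 0 ≤ choi P ∧ 0 ≤ transposeBobChoi (choi P) ∧ traceSnd (choi P) = 1 := by
  rw [IsCPPTP, IsChannel, isCP_iff_choi_posSemidef, isCP_iff_choi_posSemidef,
    trace_preserving_iff, choi_partialTranspose, Matrix.nonneg_iff_posSemidef,
    Matrix.nonneg_iff_posSemidef, and_assoc, and_comm (a := traceSnd _ = 1)]

omit [DecidableEq A] [DecidableEq B] [DecidableEq E] [DecidableEq G] in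
theorem isChannel_simulate {P : Superop ((A × B) × (E × G)) (A₂ × B₂)} (hP : IsChannel P)
    {ρ : Matrix (E × G) (E × G) ℂ} (hρ : IsState ρ) : IsChannel (simulate P ρ) := by
  refine ⟨hP.1.simulate hρ.1, fun X => ?_⟩
  rw [show simulate P ρ X = P (X ⊗ₖ ρ) from rfl, hP.2, Matrix.trace_kronecker, hρ.2, mul_one]

end Simulation

section EntanglementFidelity

variable {m n : Type*} [Fintype m] [Fintype n]

theorem trace_submatrix_equiv (e : m ≃ n) (X : Matrix n n ℂ) :
    (X.submatrix e e).trace = X.trace :=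
  e.sum_comp fun i => X i i

theorem trace_traceSnd (X : Matrix (m × n) (m × n) ℂ) : (traceSnd X).trace = X.trace :=
  (Fintype.sum_prod_type fun p => X p p).symm

omit [Fintype m] in
theorem traceSnd_add (X Y : Matrix (m × n) (m × n) ℂ) :
    traceSnd (X + Y) = traceSnd X + traceSnd Y := by
  ext i j
  simp only [traceSnd, Matrix.of_apply, Matrix.add_apply, Finset.sum_add_distrib]

omit [Fintype m] in
theorem traceSnd_smul (c : ℝ) (X : Matrix (m × n) (m × n) ℂ) :
    traceSnd (c • X) = c • traceSnd X := by
  ext i j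
  simp only [traceSnd, Matrix.of_apply, Matrix.smul_apply, Finset.smul_sum]

theorem traceSnd_maxEnt [DecidableEq m] : traceSnd (maxEnt m) = 1 := by
  ext i j
  simp [traceSnd, maxEnt, Matrix.one_apply, ite_and, eq_comm]

theorem trace_maxEnt [DecidableEq m] : (maxEnt m).trace = Fintype.card m := by
  rw [← trace_traceSnd, traceSnd_maxEnt, Matrix.trace_one]

theorem eq_of_trace_preserving_of_subsingleton [Subsingleton n] {N M : Superop m n}
    (hN : ∀ X, (N X).trace = X.trace) (hM : ∀ X, (M X).trace = X.trace) : N = M := by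
  refine LinearMap.ext fun X => Matrix.ext fun a b => ?_
  have h := (hN X).trans (hM X).symm
  rw [Matrix.trace, Matrix.trace, Fintype.sum_subsingleton _ a, Fintype.sum_subsingleton _ a] at h
  rwa [Subsingleton.elim b a]

theorem IsChannel.nonempty_output [Nonempty m] {N : Superop m n} (hN : IsChannel N) :
    Nonempty n := by
  classical
  by_contra h
  have := not_nonempty_iff.1 h
  simpa [eq_comm] using hN.2 1

variable [DecidableEq m]

theorem IsChannel.trace_choi {N : Superop m n} (hN : IsChannel N) :
    (choi N).trace = (Fintype.card m : ℝ) := by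
  rw [← trace_traceSnd, trace_preserving_iff.1 hN.2, Matrix.trace_one, Complex.ofReal_natCast]

/-- The entanglement fidelity of `M` with `N`: the overlap of their normalized Choi operators. It
is the fidelity of the output states on a maximally entangled input when the Choi operator of `N`
is pure. -/
noncomputable def entFid (N M : Superop m n) : ℝ :=
  (choi N * choi M).trace.re / (Fintype.card m : ℝ) ^ 2

theorem entFid_nonneg {N M : Superop m n} (hN : IsCP N) (hM : IsCP M) : 0 ≤ entFid N M :=
  div_nonneg (Complex.le_def.1 (trace_mul_nonneg (isCP_iff_choi_posSemidef.1 hN)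
    (isCP_iff_choi_posSemidef.1 hM))).1 (sq_nonneg _)

theorem entFid_self [Nonempty m] {N : Superop m n} (hN : IsChannel N) (hpure : IsPure (choi N)) :
    entFid N N = 1 := by
  rw [entFid, hpure.mul_self, Matrix.trace_smul, hN.trace_choi, smul_eq_mul, ← Complex.ofReal_mul,
    Complex.ofReal_re, ← sq, div_self (by positivity)]

variable (m n) in
/-- The identification `R ⊗ n ≃ m ⊗ n` of the reference system `R = ℂ^(card m)` with `m`. -/
noncomputable def referenceEquiv : Fin (Fintype.card m) × n ≃ m × n :=
  Equiv.prodCongr (Fintype.equivFin m).symm (Equiv.refl n)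

variable (m) in
/-- The normalized maximally entangled state, with its reference system indexed by `Fin (card m)` as
in the definitions of the diamond distance and of the channel fidelity. -/
noncomputable def maxEntState : Matrix (Fin (Fintype.card m) × m) (Fin (Fintype.card m) × m) ℂ :=
  (Fintype.card m : ℝ)⁻¹ • (maxEnt m).submatrix (referenceEquiv m m) (referenceEquiv m m)

theorem isState_maxEntState [Nonempty m] : IsState (maxEntState m) := by
  refine ⟨(isPure_maxEnt.posSemidef.submatrix _).smul (by positivity), ?_⟩
  rw [maxEntState, Matrix.trace_smul, trace_submatrix_equiv, trace_maxEnt,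
    Complex.real_smul]
  simp

omit [Fintype n] in
theorem ampliate_maxEntState (M : Superop m n) :
    ampliate M (maxEntState m) = (Fintype.card m : ℝ)⁻¹ •
      (choi M).submatrix (referenceEquiv m n) (referenceEquiv m n) := by
  ext p q
  exact congrFun (congrFun (M.map_smul_of_tower (Fintype.card m : ℝ)⁻¹ _) p.2) q.2

theorem re_trace_ampliate_maxEntState_mul (N M : Superop m n) :
    (ampliate N (maxEntState m) * ampliate M (maxEntState m)).trace.re = entFid N M := by
  rw [ampliate_maxEntState, ampliate_maxEntState, smul_mul_smul_comm, Matrix.submatrix_mul_equiv,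
    Matrix.trace_smul, trace_submatrix_equiv, Complex.real_smul, Complex.re_ofReal_mul,
    entFid]
  ring

omit [Fintype n] in
theorem isPure_ampliate_maxEntState {N : Superop m n} (hpure : IsPure (choi N)) :
    IsPure (ampliate N (maxEntState m)) :=
  ampliate_maxEntState N ▸ (hpure.submatrix _).smul (by positivity)

variable [Nonempty m] [DecidableEq n] {N M : Superop m n}

theorem channelFidelity_le_entFid (hN : IsChannel N) (hpure : IsPure (choi N))
    (hM : IsChannel M) : channelFidelity N M ≤ entFid N M := by
  refine csInf_le ⟨0, ?_⟩ ⟨_, maxEntState m, isState_maxEntState, ?_⟩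
  · rintro x ⟨r, σ, -, rfl⟩
    exact sq_nonneg _
  · rw [fidelity_of_isPure (isState_ampliate hN isState_maxEntState)
      (isPure_ampliate_maxEntState hpure) (isState_ampliate hM isState_maxEntState).1,
      re_trace_ampliate_maxEntState_mul]

theorem one_sub_entFid_le_diamondDist (hN : IsChannel N) (hpure : IsPure (choi N))
    (hM : IsChannel M) : 1 - entFid N M ≤ 1 / 2 * diamondDist N M := by
  have hle : traceNorm (ampliate N (maxEntState m) - ampliate M (maxEntState m)) ≤
      diamondDist N M := by
    refine le_csSup ⟨2, ?_⟩ ⟨_, maxEntState m, isState_maxEntState, rfl⟩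
    rintro x ⟨r, σ, hσ, rfl⟩
    have hNσ := isState_ampliate hN hσ
    have hMσ := isState_ampliate hM hσ
    have h := traceNorm_sub_le hNσ.1 hMσ.1
    rwa [hNσ.2, hMσ.2, Complex.one_re, one_add_one_eq_two] at h
  have h := one_sub_re_trace_mul_le_traceNorm (isState_ampliate hN isState_maxEntState)
    (isPure_ampliate_maxEntState hpure) (isState_ampliate hM isState_maxEntState).2
  rw [re_trace_ampliate_maxEntState_mul] at h
  linarith

end EntanglementFidelity

section Dominated

variable {m n : Type*} [Fintype m] [Fintype n] {N M : Superop m n} {f : ℝ}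

omit [Fintype m] [Fintype n] in
theorem ampliate_sub_smul {k : Type*} (N M : Superop m n) (f : ℝ) (X : Matrix (k × m) (k × m) ℂ) :
    ampliate (M - f • N) X = ampliate M X - f • ampliate N X := rfl

theorem le_one_of_isCP_sub_smul [Nonempty m] (hN : IsChannel N) (hM : IsChannel M)
    (hMN : IsCP (M - f • N)) : f ≤ 1 := by
  classical
  have h := re_trace_nonneg (hMN _ _ (isState_maxEntState (m := m)).1)
  rw [ampliate_sub_smul, Matrix.trace_sub, Matrix.trace_smul,
    (isState_ampliate hN isState_maxEntState).2, (isState_ampliate hM isState_maxEntState).2] at h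
  simpa using h

theorem le_entFid_of_isCP_sub_smul [DecidableEq m] [Nonempty m] (hN : IsChannel N)
    (hpure : IsPure (choi N)) (hMN : IsCP (M - f • N)) : f ≤ entFid N M := by
  have h := entFid_nonneg hN.1 hMN
  have hsub : entFid N (M - f • N) = entFid N M - f * entFid N N := by
    simp only [entFid]
    rw [show choi (M - f • N) = choi M - f • choi N from rfl, mul_sub, Matrix.mul_smul,
      Matrix.trace_sub, Matrix.trace_smul, Complex.sub_re, Complex.real_smul,
      Complex.re_ofReal_mul]
    ring
  rw [hsub, entFid_self hN hpure] at h
  linarith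

theorem le_channelFidelity_of_isCP_sub_smul [Nonempty m] [DecidableEq n] (hf : 0 ≤ f)
    (hN : IsChannel N) (hMN : IsCP (M - f • N)) : f ≤ channelFidelity N M := by
  classical
  refine le_csInf ⟨_, _, maxEntState m, isState_maxEntState, rfl⟩ ?_
  rintro x ⟨r, σ, hσ, rfl⟩
  exact le_fidelity_of_smul_le hf (isState_ampliate hN hσ) (Matrix.le_iff.2 (hMN r σ hσ.1))

theorem diamondDist_le_of_isCP_sub_smul [DecidableEq n] (hf : f ≤ 1)
    (hN : IsChannel N) (hM : IsChannel M) (hMN : IsCP (M - f • N)) :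
    1 / 2 * diamondDist N M ≤ 1 - f := by
  have h : diamondDist N M ≤ 2 * (1 - f) := by
    refine Real.sSup_le ?_ (by linarith)
    rintro x ⟨r, σ, hσ, rfl⟩
    have hNσ := isState_ampliate hN hσ
    have hMσ := isState_ampliate hM hσ
    calc traceNorm (ampliate N σ - ampliate M σ)
        = traceNorm ((1 - f) • ampliate N σ - ampliate (M - f • N) σ) := by
          rw [ampliate_sub_smul]
          congr 1
          module
      _ ≤ ((1 - f) • ampliate N σ).trace.re + (ampliate (M - f • N) σ).trace.re :=
          traceNorm_sub_le (hNσ.1.smul (sub_nonneg.2 hf)) (hMN r σ hσ.1)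
      _ = 2 * (1 - f) := by
          rw [ampliate_sub_smul, Matrix.trace_sub, Matrix.trace_smul, Matrix.trace_smul, hNσ.2,
            hMσ.2]
          simp
          ring
  linarith

end Dominated

section BlockMatrix

variable {n : Type*} {J C Q : Matrix n n ℂ}

theorem mulVec_eq_zero_of_fromBlocks_posSemidef [Fintype n]
    (hB : (Matrix.fromBlocks J Qᴴ Q C).PosSemidef) {v : n → ℂ} (hv : J *ᵥ v = 0) :
    Q *ᵥ v = 0 := by
  have h := (hB.dotProduct_mulVec_zero_iff (Sum.elim v 0)).1 (by
    simp [Matrix.fromBlocks_mulVec, Function.star_sumElim, Sum.elim_comp_inl, Sum.elim_comp_inr,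
      hv])
  rw [Matrix.fromBlocks_mulVec, Sum.elim_comp_inl, Sum.elim_comp_inr, Matrix.mulVec_zero,
    Matrix.mulVec_zero, add_zero, add_zero] at h
  exact funext fun i => congrFun h (Sum.inr i)

theorem IsPure.mul_eq_smul_of_fromBlocks_posSemidef [Fintype n] (hJ : IsPure J)
    (hB : (Matrix.fromBlocks J Qᴴ Q C).PosSemidef) : Q * J = J.trace • Q := by
  classical
  refine Matrix.ext_of_mulVec_single fun i => ?_
  have h := mulVec_eq_zero_of_fromBlocks_posSemidef hB
    (v := (J - J.trace • 1) *ᵥ Pi.single i 1)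
    (by rw [Matrix.mulVec_mulVec, mul_sub, hJ.mul_self, Matrix.mul_smul, mul_one, sub_self,
      Matrix.zero_mulVec])
  rwa [Matrix.mulVec_mulVec, mul_sub, Matrix.mul_smul, mul_one, Matrix.sub_mulVec,
    sub_eq_zero] at h

theorem IsPure.sq_mul_trace_le_of_fromBlocks_posSemidef [Fintype n] (hJ : IsPure J)
    (hB : (Matrix.fromBlocks J Qᴴ Q C).PosSemidef) {l : ℝ} (hl : 0 ≤ l)
    (hQ : l * J.trace.re ≤ Q.trace.re) : (l * J.trace.re) ^ 2 ≤ (J * C).trace.re := by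
  classical
  have hD : J.trace = (J.trace.re : ℂ) := Complex.eq_re_of_ofReal_le hJ.posSemidef.trace_nonneg
  have hD0 : 0 ≤ J.trace.re := re_trace_nonneg hJ.posSemidef
  have hJQ : (J * Q).trace.re = J.trace.re * Q.trace.re := by
    rw [Matrix.trace_mul_comm, hJ.mul_eq_smul_of_fromBlocks_posSemidef hB, hD, Matrix.trace_smul,
      smul_eq_mul, Complex.re_ofReal_mul, Complex.ofReal_re]
  have hJQ' : (J * Qᴴ).trace.re = J.trace.re * Q.trace.re := by
    rw [Matrix.trace_mul_comm, re_trace_conjTranspose_mul hJ.posSemidef.isHermitian,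
      Matrix.trace_mul_comm, hJQ]
  have hJJ : (J * J).trace.re = J.trace.re * J.trace.re := by
    rw [hJ.mul_self, hD, Matrix.trace_smul, smul_eq_mul, Complex.re_ofReal_mul, Complex.ofReal_re]
  -- Compress to the vectors `(l v, -v)` and pair with `J`, using `Q J = Tr[J] Q`.
  let V : Matrix (n ⊕ n) n ℂ := Matrix.fromRows (l • (1 : Matrix n n ℂ)) (-1 : Matrix n n ℂ)
  have hcompress : Vᴴ * Matrix.fromBlocks J Qᴴ Q C * V = l ^ 2 • J - l • Q - l • Qᴴ + C := by
    rw [Matrix.conjTranspose_fromRows_eq_fromCols_conjTranspose, Matrix.fromCols_mul_fromBlocks,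
      Matrix.fromCols_mul_fromRows]
    simp only [Matrix.conjTranspose_smul, Matrix.conjTranspose_one, Matrix.conjTranspose_neg,
      star_trivial, smul_mul_assoc, mul_smul_comm, mul_neg, neg_mul, mul_one, one_mul]
    module
  have hpos := (Complex.le_def.1 (trace_mul_nonneg hJ.posSemidef
    (hcompress ▸ hB.conjTranspose_mul_mul_same V))).1
  simp only [mul_add, mul_sub, Matrix.mul_smul, Matrix.trace_add, Matrix.trace_sub,
    Matrix.trace_smul, Complex.real_smul, Complex.add_re, Complex.sub_re, Complex.re_ofReal_mul,
    hJJ, hJQ, hJQ', Complex.zero_re] at hpos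
  nlinarith [mul_le_mul_of_nonneg_left hQ (mul_nonneg hl hD0)]

theorem fromBlocks_smul_posSemidef [Finite n] (hJ : J.PosSemidef) (s : ℝ)
    (hC : (C - s ^ 2 • J).PosSemidef) :
    (Matrix.fromBlocks J (s • J)ᴴ (s • J) C).PosSemidef := by
  classical
  have := Fintype.ofFinite n
  let U : Matrix n (n ⊕ n) ℂ := Matrix.fromCols (1 : Matrix n n ℂ) (s • (1 : Matrix n n ℂ))
  let V : Matrix n (n ⊕ n) ℂ := Matrix.fromCols (0 : Matrix n n ℂ) (1 : Matrix n n ℂ)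
  have hblocks : Uᴴ * J * U + Vᴴ * (C - s ^ 2 • J) * V =
      Matrix.fromBlocks J (s • J)ᴴ (s • J) C := by
    simp only [U, V, Matrix.conjTranspose_fromCols_eq_fromRows_conjTranspose]
    rw [Matrix.fromRows_mul, Matrix.fromRows_mul_fromCols, Matrix.fromRows_mul,
      Matrix.fromRows_mul_fromCols, Matrix.fromBlocks_add]
    simp only [Matrix.conjTranspose_smul,
      Matrix.conjTranspose_one, Matrix.conjTranspose_zero, star_trivial, smul_mul_assoc,
      mul_smul_comm, one_mul, mul_one, zero_mul, mul_zero, add_zero, smul_smul, hJ.isHermitian.eq]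
    congr 1
    module
  exact hblocks ▸ (hJ.conjTranspose_mul_mul_same U).add (hC.conjTranspose_mul_mul_same V)

end BlockMatrix

section SimulationErrors

theorem sInf_eq_one_sub_sSup {S F : Set ℝ} (hF : F.Nonempty) (hbdd : BddAbove F)
    (hSF : ∀ x ∈ S, ∃ f ∈ F, 1 - f ≤ x) (hFS : ∀ f ∈ F, ∃ x ∈ S, x ≤ 1 - f) :
    sInf S = 1 - sSup F := by
  have hlower : ∀ x ∈ S, 1 - sSup F ≤ x := fun x hx => by
    obtain ⟨f, hf, hfx⟩ := hSF x hx
    linarith [le_csSup hbdd hf]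
  have hupper : sSup F ≤ 1 - sInf S := csSup_le hF fun f hf => by
    obtain ⟨x, hx, hxf⟩ := hFS f hf
    linarith [csInf_le ⟨_, hlower⟩ hx]
  obtain ⟨f, hf⟩ := hF
  obtain ⟨x, hx, -⟩ := hFS f hf
  exact le_antisymm (by linarith) (le_csInf ⟨x, hx⟩ hlower)

theorem sSup_sq_eq_sSup {S F : Set ℝ} (hS : ∀ l ∈ S, 0 ≤ l ∧ ∃ f ∈ F, l ^ 2 ≤ f)
    (hF : F.Nonempty) (hbdd : BddAbove F) (hF0 : ∀ f ∈ F, 0 ≤ f) (hFS : ∀ f ∈ F, √f ∈ S) :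
    sSup S ^ 2 = sSup F := by
  have hle : ∀ l ∈ S, l ≤ √(sSup F) := fun l hl => by
    obtain ⟨-, f, hf, hlf⟩ := hS l hl
    exact Real.le_sqrt_of_sq_le (hlf.trans (le_csSup hbdd hf))
  have hS0 : 0 ≤ sSup S := Real.sSup_nonneg fun l hl => (hS l hl).1
  refine le_antisymm ?_ (csSup_le hF fun f hf => ?_)
  · calc sSup S ^ 2 ≤ √(sSup F) ^ 2 := by
          gcongr
          exact Real.sSup_le hle (Real.sqrt_nonneg _)
      _ = sSup F := Real.sq_sqrt (Real.sSup_nonneg hF0)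
  · calc f = √f ^ 2 := (Real.sq_sqrt (hF0 f hf)).symm
      _ ≤ sSup S ^ 2 := by
          gcongr
          exact le_csSup ⟨_, hle⟩ (hFS f hf)

variable {A B A₂ B₂ E G : Type*} [Fintype A] [Fintype B] [Fintype A₂] [Fintype B₂] [Fintype E]
  [Fintype G]

theorem exists_isCPPTP [Nonempty (A₂ × B₂)] :
    ∃ P : Superop ((A × B) × (E × G)) (A₂ × B₂), IsCPPTP P := by
  classical
  set c : ℝ := (Fintype.card (A₂ × B₂) : ℝ)⁻¹
  have hpos : 0 ≤ (c • 1 :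
      Matrix (((A × B) × (E × G)) × (A₂ × B₂)) (((A × B) × (E × G)) × (A₂ × B₂)) ℂ) :=
    (Matrix.PosSemidef.one.smul (inv_nonneg.2 (Nat.cast_nonneg _))).nonneg
  refine ⟨ofChoi (c • 1), isCPPTP_iff.2 ?_⟩
  rw [choi_ofChoi]
  refine ⟨hpos, hpos.trans_eq ?_, ?_⟩
  · ext p q
    simp only [transposeBobChoi, Matrix.of_apply, Matrix.smul_apply, Matrix.one_apply, Prod.ext_iff]
    congr 1
    exact if_congr (by tauto) rfl rfl
  · ext i j
    simp only [traceSnd, Matrix.of_apply, Matrix.smul_apply, Matrix.one_apply, Prod.mk.injEq,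
      and_true, Finset.sum_const, Finset.card_univ, ← Nat.cast_smul_eq_nsmul ℝ, smul_smul]
    rw [mul_inv_cancel₀ (Nat.cast_ne_zero.2 Fintype.card_ne_zero), one_smul]

variable [DecidableEq A] [DecidableEq B]

/-- The entanglement fidelities with `N` of its C-PPT-P simulations with resource `ρ`. -/
def simulationEntFids (N : Superop (A × B) (A₂ × B₂)) (ρ : Matrix (E × G) (E × G) ℂ) : Set ℝ :=
  {f | ∃ P : Superop ((A × B) × (E × G)) (A₂ × B₂),
    IsCPPTP P ∧ f = entFid N (simulate P ρ)}

/-- Every C-PPT-P simulation of `N` can be replaced by one that dominates `f • N`, where `f` is the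
entanglement fidelity of the original simulation with `N`. This is what twirling by the symmetries
of `N` achieves. -/
def IsTwirlable (N : Superop (A × B) (A₂ × B₂)) (ρ : Matrix (E × G) (E × G) ℂ) : Prop :=
  ∀ f ∈ simulationEntFids N ρ, ∃ P : Superop ((A × B) × (E × G)) (A₂ × B₂),
    IsCPPTP P ∧ IsCP (simulate P ρ - f • N)

variable {N : Superop (A × B) (A₂ × B₂)} {ρ : Matrix (E × G) (E × G) ℂ}

theorem nonneg_of_mem_simulationEntFids (hN : IsChannel N) (hρ : IsState ρ) {f : ℝ}
    (hf : f ∈ simulationEntFids N ρ) : 0 ≤ f := by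
  obtain ⟨P, hP, rfl⟩ := hf
  exact entFid_nonneg hN.1 (isChannel_simulate hP.1 hρ).1

variable [Nonempty (A × B)]

theorem simulationEntFids_nonempty (hN : IsChannel N) : (simulationEntFids N ρ).Nonempty := by
  have := hN.nonempty_output
  obtain ⟨P, hP⟩ := exists_isCPPTP (A := A) (B := B) (A₂ := A₂) (B₂ := B₂) (E := E) (G := G)
  exact ⟨_, P, hP, rfl⟩

theorem isTwirlable_of_subsingleton [Subsingleton (A₂ × B₂)] (hN : IsChannel N)
    (hpure : IsPure (choi N)) (hρ : IsState ρ) : IsTwirlable N ρ := by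
  rintro f ⟨P, hP, rfl⟩
  have heq : simulate P ρ = N :=
    eq_of_trace_preserving_of_subsingleton (isChannel_simulate hP.1 hρ).2 hN.2
  refine ⟨P, hP, ?_⟩
  rw [heq, entFid_self hN hpure, one_smul, sub_self]
  exact fun r X _ => Matrix.PosSemidef.zero

theorem IsTwirlable.le_one (htwirl : IsTwirlable N ρ) (hN : IsChannel N) (hρ : IsState ρ) {f : ℝ}
    (hf : f ∈ simulationEntFids N ρ) : f ≤ 1 := by
  obtain ⟨P, hP, hPf⟩ := htwirl f hf
  exact le_one_of_isCP_sub_smul hN (isChannel_simulate hP.1 hρ) hPf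

theorem IsTwirlable.bddAbove (htwirl : IsTwirlable N ρ) (hN : IsChannel N) (hρ : IsState ρ) :
    BddAbove (simulationEntFids N ρ) :=
  ⟨1, fun _ => htwirl.le_one hN hρ⟩

theorem IsTwirlable.errPPTInfid_eq [DecidableEq A₂] [DecidableEq B₂] (htwirl : IsTwirlable N ρ)
    (hN : IsChannel N) (hpure : IsPure (choi N)) (hρ : IsState ρ) :
    errPPTInfid N ρ = 1 - sSup (simulationEntFids N ρ) := by
  refine sInf_eq_one_sub_sSup (simulationEntFids_nonempty hN) (htwirl.bddAbove hN hρ) ?_ ?_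
  · rintro x ⟨P, hP, rfl⟩
    exact ⟨_, ⟨P, hP, rfl⟩,
      sub_le_sub_left (channelFidelity_le_entFid hN hpure (isChannel_simulate hP.1 hρ)) 1⟩
  · intro f hf
    obtain ⟨P, hP, hPf⟩ := htwirl f hf
    exact ⟨_, ⟨P, hP, rfl⟩, sub_le_sub_left
      (le_channelFidelity_of_isCP_sub_smul (nonneg_of_mem_simulationEntFids hN hρ hf) hN hPf) 1⟩

theorem IsTwirlable.errPPT_eq [DecidableEq A₂] [DecidableEq B₂] (htwirl : IsTwirlable N ρ)
    (hN : IsChannel N) (hpure : IsPure (choi N)) (hρ : IsState ρ) :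
    errPPT N ρ = 1 - sSup (simulationEntFids N ρ) := by
  refine sInf_eq_one_sub_sSup (simulationEntFids_nonempty hN) (htwirl.bddAbove hN hρ) ?_ ?_
  · rintro x ⟨P, hP, rfl⟩
    exact ⟨_, ⟨P, hP, rfl⟩,
      one_sub_entFid_le_diamondDist hN hpure (isChannel_simulate hP.1 hρ)⟩
  · intro f hf
    obtain ⟨P, hP, hPf⟩ := htwirl f hf
    exact ⟨_, ⟨P, hP, rfl⟩, diamondDist_le_of_isCP_sub_smul (htwirl.le_one hN hρ hf) hN
      (isChannel_simulate hP.1 hρ) hPf⟩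

omit [Fintype E] [Fintype G] in
theorem sq_le_entFid_of_fromBlocks_nonneg (hN : IsChannel N) (hpure : IsPure (choi N))
    {M : Superop (A × B) (A₂ × B₂)} {l : ℝ} (hl : 0 ≤ l)
    {Q : Matrix ((A × B) × (A₂ × B₂)) ((A × B) × (A₂ × B₂)) ℂ}
    (hQ : l • (1 : Matrix (A × B) (A × B) ℂ) ≤ hermPart (traceSnd Q))
    (hB : 0 ≤ Matrix.fromBlocks (choi N) Qᴴ Q (choi M)) : l ^ 2 ≤ entFid N M := by
  have hlQ : l * (choi N).trace.re ≤ Q.trace.re := by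
    have h := re_trace_nonneg (Matrix.le_iff.1 hQ)
    rw [Matrix.trace_sub, hermPart, Matrix.trace_smul, Matrix.trace_smul, Matrix.trace_add,
      Matrix.trace_conjTranspose, trace_traceSnd, Matrix.trace_one] at h
    simp only [Complex.sub_re, Complex.real_smul, Complex.re_ofReal_mul, Complex.add_re,
      RCLike.star_def, Complex.conj_re, Complex.natCast_re] at h
    rw [hN.trace_choi, Complex.ofReal_re]
    linarith
  have h := hpure.sq_mul_trace_le_of_fromBlocks_posSemidef (Matrix.nonneg_iff_posSemidef.1 hB) hl
    hlQ
  rw [hN.trace_choi, Complex.ofReal_re, mul_pow] at h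
  exact (le_div_iff₀ (by positivity)).2 h

omit [Nonempty (A × B)] in
theorem hermPart_traceSnd_smul_choi (hN : IsChannel N) (s : ℝ) :
    hermPart (traceSnd (s • choi N)) = s • (1 : Matrix (A × B) (A × B) ℂ) := by
  rw [traceSnd_smul, trace_preserving_iff.1 hN.2, hermPart, Matrix.conjTranspose_smul,
    Matrix.conjTranspose_one, star_trivial]
  module

theorem IsTwirlable.infidSDP_eq [DecidableEq E] [DecidableEq G] (htwirl : IsTwirlable N ρ)
    (hN : IsChannel N) (hpure : IsPure (choi N)) (hρ : IsState ρ) :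
    infidSDP N ρ = 1 - sSup (simulationEntFids N ρ) := by
  refine congrArg (1 - ·) (sSup_sq_eq_sSup ?_ (simulationEntFids_nonempty hN)
    (htwirl.bddAbove hN hρ) (fun f => nonneg_of_mem_simulationEntFids hN hρ) fun f hf => ?_)
  · rintro l ⟨hl, P, Q, hP, hQ, hPT, htrace, hB⟩
    have hcppt : IsCPPTP (ofChoi P) := isCPPTP_iff.2 (by rw [choi_ofChoi]; exact ⟨hP, hPT, htrace⟩)
    refine ⟨hl, _, ⟨ofChoi P, hcppt, rfl⟩, sq_le_entFid_of_fromBlocks_nonneg hN hpure hl hQ ?_⟩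
    rwa [choi_simulate, choi_ofChoi]
  · obtain ⟨P, hP, hPf⟩ := htwirl f hf
    obtain ⟨hP0, hPT, htrace⟩ := isCPPTP_iff.1 hP
    refine ⟨Real.sqrt_nonneg f, choi P, √f • choi N, hP0,
      (hermPart_traceSnd_smul_choi hN √f).ge, hPT, htrace, ?_⟩
    rw [← choi_simulate, Matrix.nonneg_iff_posSemidef]
    refine fromBlocks_smul_posSemidef hpure.posSemidef √f ?_
    rw [Real.sq_sqrt (nonneg_of_mem_simulationEntFids hN hρ hf)]
    exact isCP_iff_choi_posSemidef.1 hPf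

end SimulationErrors

section Contraction

variable {I R O : Type*}

/-- The operator on `I R O` that is `W` on `I O` and `Kᵀ` on `R`. With the transpose, contracting a
resource `ρ` on `R` as in `contractResource` yields `Tr[ρ K] W`. -/
def glue (W : Matrix (I × O) (I × O) ℂ) (K : Matrix R R ℂ) :
    Matrix ((I × R) × O) ((I × R) × O) ℂ :=
  (W ⊗ₖ Kᵀ).submatrix (fun p => ((p.1.1, p.2), p.1.2)) fun p => ((p.1.1, p.2), p.1.2)

theorem glue_posSemidef [Finite I] [Finite R] [Finite O] {W : Matrix (I × O) (I × O) ℂ}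
    {K : Matrix R R ℂ} (hW : W.PosSemidef) (hK : K.PosSemidef) : (glue W K).PosSemidef :=
  (hW.kronecker hK.transpose).submatrix _

theorem traceSnd_glue [Fintype O] (W : Matrix (I × O) (I × O) ℂ) (K : Matrix R R ℂ) :
    traceSnd (glue W K) = traceSnd W ⊗ₖ Kᵀ := by
  ext ⟨i, r⟩ ⟨j, s⟩
  exact (Finset.sum_mul Finset.univ (fun o => W (i, o) (j, o)) (K s r)).symm

variable [Fintype I] [Fintype O]

/-- The map `W ↦ Tr_{I O}[P W]ᵀ` for an operator `P` on `I R O`: the adjoint of `contractResource`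
with respect to the pairing `Tr[X Y]`. -/
def contract (P : Matrix ((I × R) × O) ((I × R) × O) ℂ) : Superop (I × O) R where
  toFun W := Matrix.of fun h l => ∑ p, ∑ q, W q p * P ((p.1, l), p.2) ((q.1, h), q.2)
  map_add' W W' := by
    ext h l
    simp [add_mul, Finset.sum_add_distrib]
  map_smul' c W := by
    ext h l
    simp [Finset.mul_sum, mul_assoc]

theorem contract_apply (P : Matrix ((I × R) × O) ((I × R) × O) ℂ) (W : Matrix (I × O) (I × O) ℂ)
    (h l : R) :
    contract P W h l = ∑ p, ∑ q, W q p * P ((p.1, l), p.2) ((q.1, h), q.2) := rfl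

theorem contract_posSemidef [Finite R] {P : Matrix ((I × R) × O) ((I × R) × O) ℂ}
    (hP : P.PosSemidef) {W : Matrix (I × O) (I × O) ℂ} (hW : W.PosSemidef) :
    (contract P W).PosSemidef :=
  (ofChoi_posSemidef (hP.submatrix fun x : (I × O) × R => ((x.1.1, x.2), x.1.2))
    hW.transpose).transpose

theorem contract_one [DecidableEq I] [DecidableEq R] [DecidableEq O]
    {P : Matrix ((I × R) × O) ((I × R) × O) ℂ} (hP : traceSnd P = 1) :
    contract P 1 = (Fintype.card I : ℝ) • 1 := by
  ext h l
  have hsum (i : I) : ∑ o, P ((i, l), o) ((i, h), o) = if h = l then 1 else 0 := by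
    simpa [traceSnd, Matrix.one_apply, eq_comm] using congrFun (congrFun hP (i, l)) (i, h)
  simp [contract_apply, Matrix.one_apply, Fintype.sum_prod_type, hsum]

end Contraction

section Splice

variable {A B A₂ B₂ E G : Type*}

/-- The operator on `A B A' B'` that is `x` on `A B'` and `y` on `B A'`. -/
def splice (x : Matrix (A × B₂) (A × B₂) ℂ) (y : Matrix (B × A₂) (B × A₂) ℂ) :
    Matrix ((A × B) × (A₂ × B₂)) ((A × B) × (A₂ × B₂)) ℂ :=
  (x ⊗ₖ y).submatrix (fun p => ((p.1.1, p.2.2), (p.1.2, p.2.1)))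
    fun p => ((p.1.1, p.2.2), (p.1.2, p.2.1))

theorem splice_posSemidef [Finite A] [Finite B] [Finite A₂] [Finite B₂]
    {x : Matrix (A × B₂) (A × B₂) ℂ} {y : Matrix (B × A₂) (B × A₂) ℂ} (hx : x.PosSemidef)
    (hy : y.PosSemidef) : (splice x y).PosSemidef :=
  (hx.kronecker hy).submatrix _

theorem IsPure.splice {x : Matrix (A × B₂) (A × B₂) ℂ} {y : Matrix (B × A₂) (B × A₂) ℂ}
    (hx : IsPure x) (hy : IsPure y) : IsPure (splice x y) := by
  obtain ⟨γ, rfl⟩ := hx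
  obtain ⟨δ, rfl⟩ := hy
  refine ⟨fun p => γ (p.1.1, p.2.2) * δ (p.1.2, p.2.1), Matrix.ext fun p q => ?_⟩
  simp only [BQT.splice, Matrix.submatrix_apply, Matrix.kroneckerMap_apply,
    Matrix.vecMulVec_apply, Pi.star_apply, star_mul']
  ring

theorem splice_one [DecidableEq A] [DecidableEq B] [DecidableEq A₂] [DecidableEq B₂] :
    splice (1 : Matrix (A × B₂) (A × B₂) ℂ) (1 : Matrix (B × A₂) (B × A₂) ℂ) = 1 := by
  rw [splice, Matrix.one_kronecker_one]
  refine Matrix.submatrix_one _ ?_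
  rintro ⟨⟨a, b⟩, ⟨a', b'⟩⟩ ⟨⟨i, j⟩, ⟨i', j'⟩⟩ h
  grind

theorem traceSnd_splice [Fintype A₂] [Fintype B₂] (x : Matrix (A × B₂) (A × B₂) ℂ)
    (y : Matrix (B × A₂) (B × A₂) ℂ) : traceSnd (splice x y) = traceSnd x ⊗ₖ traceSnd y := by
  ext ⟨a, b⟩ ⟨a', b'⟩
  simp only [traceSnd, splice, Matrix.of_apply, Matrix.submatrix_apply, Matrix.kroneckerMap_apply,
    Fintype.sum_prod_type_right, Finset.sum_mul_sum]

theorem contractResource_sub [Fintype E] [Fintype G] (ρ : Matrix (E × G) (E × G) ℂ)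
    (P Q : Matrix (((A × B) × (E × G)) × (A₂ × B₂)) (((A × B) × (E × G)) × (A₂ × B₂)) ℂ) :
    contractResource ρ (P - Q) = contractResource ρ P - contractResource ρ Q := by
  ext p q
  simp only [contractResource, Matrix.of_apply, Matrix.sub_apply, mul_sub, Finset.sum_sub_distrib]

theorem contractResource_glue [Fintype E] [Fintype G] (ρ K : Matrix (E × G) (E × G) ℂ)
    (W : Matrix ((A × B) × (A₂ × B₂)) ((A × B) × (A₂ × B₂)) ℂ) :
    contractResource ρ (glue W K) = (ρ * K).trace • W := by
  ext p q
  simp only [contractResource, glue, Matrix.of_apply, Matrix.transpose_apply,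
    Matrix.submatrix_apply, Matrix.kronecker_apply, Matrix.smul_apply, Matrix.trace,
    Matrix.diag_apply, Matrix.mul_apply, smul_eq_mul, Finset.sum_mul]
  rw [Finset.sum_comm]
  exact Finset.sum_congr rfl fun h _ => Finset.sum_congr rfl fun l _ => by ring

variable [Fintype A] [Fintype B] [Fintype A₂] [Fintype B₂]

theorem transposeSnd_contract_splice
    (P : Matrix (((A × B) × (E × G)) × (A₂ × B₂)) (((A × B) × (E × G)) × (A₂ × B₂)) ℂ)
    (x : Matrix (A × B₂) (A × B₂) ℂ) (y : Matrix (B × A₂) (B × A₂) ℂ) :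
    transposeSnd (contract P (splice x y)) =
      contract (transposeBobChoi P) (splice (transposeSnd x) (transposeSnd y)ᵀ) := by
  let swapBob : Equiv.Perm (((A × B) × (A₂ × B₂)) × ((A × B) × (A₂ × B₂))) :=
    Function.Involutive.toPerm
      (fun r => (((r.1.1.1, r.2.1.2), (r.1.2.1, r.2.2.2)),
        ((r.2.1.1, r.1.1.2), (r.2.2.1, r.1.2.2))))
      fun _ => rfl
  ext h l
  change contract P (splice x y) (h.1, l.2) (l.1, h.2) = _
  rw [contract_apply, contract_apply, ← Fintype.sum_prod_type', ← Fintype.sum_prod_type']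
  exact (Equiv.sum_comp swapBob _).symm

variable [Fintype E] [Fintype G]

theorem trace_mul_contract (ρ : Matrix (E × G) (E × G) ℂ)
    (P : Matrix (((A × B) × (E × G)) × (A₂ × B₂)) (((A × B) × (E × G)) × (A₂ × B₂)) ℂ)
    (W : Matrix ((A × B) × (A₂ × B₂)) ((A × B) × (A₂ × B₂)) ℂ) :
    (ρ * contract P W).trace = (W * contractResource ρ P).trace := by
  have hl : (ρ * contract P W).trace = ∑ x : (E × G) × (E × G), ∑ y : _ × _,
      ρ x.1 x.2 * (W y.2 y.1 * P ((y.1.1, x.1), y.1.2) ((y.2.1, x.2), y.2.2)) := by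
    simp only [Matrix.trace, Matrix.diag_apply, Matrix.mul_apply, contract_apply, Finset.mul_sum]
    rw [← Fintype.sum_prod_type']
    exact Finset.sum_congr rfl fun x _ => (Fintype.sum_prod_type' _).symm
  have hr : (W * contractResource ρ P).trace = ∑ y : _ × _, ∑ x : (E × G) × (E × G),
      ρ x.1 x.2 * (W y.2 y.1 * P ((y.1.1, x.1), y.1.2) ((y.2.1, x.2), y.2.2)) := by
    simp only [Matrix.trace, Matrix.diag_apply, Matrix.mul_apply, contractResource,
      Matrix.of_apply, Matrix.transpose_apply, Finset.mul_sum]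
    rw [← Fintype.sum_prod_type_right']
    refine Finset.sum_congr rfl fun y _ => ?_
    rw [← Fintype.sum_prod_type_right']
    exact Finset.sum_congr rfl fun x _ => mul_left_comm _ _ _
  rw [hl, hr, Finset.sum_comm]

end Splice

section SwapOperator

theorem posSemidef_of_mul_self_eq_smul {n : Type*} [Fintype n] {H : Matrix n n ℂ}
    (hH : H.IsHermitian) {c : ℝ} (hc : 0 < c) (hHH : H * H = c • H) : H.PosSemidef := by
  have h := (Matrix.posSemidef_conjTranspose_mul_self H).smul (inv_nonneg.2 hc.le)
  rwa [hH.eq, hHH, inv_smul_smul₀ hc.ne'] at h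

variable {d : ℕ}

theorem transposeSnd_maxEnt : transposeSnd (maxEnt (Fin d)) = swapOp d := by
  ext ⟨i, k⟩ ⟨j, l⟩
  change maxEnt (Fin d) (i, l) (j, k) = _
  simp [maxEnt, swapOp, Matrix.sum_apply, Matrix.single_apply, ite_and, eq_comm]

theorem swapOp_apply (p q : Fin d × Fin d) : swapOp d p q = if p.swap = q then 1 else 0 := by
  rw [← transposeSnd_maxEnt]
  change (if p.1 = q.2 ∧ q.1 = p.2 then 1 else 0) = _
  exact if_congr (by rw [Prod.ext_iff, and_comm, eq_comm (a := q.1)]; rfl) rfl rfl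

theorem swapOp_mul_apply (X : Matrix (Fin d × Fin d) (Fin d × Fin d) ℂ) (p q : Fin d × Fin d) :
    (swapOp d * X) p q = X p.swap q := by
  simp [Matrix.mul_apply, swapOp_apply]

theorem swapOp_mul_swapOp : swapOp d * swapOp d = 1 := by
  ext p q
  rw [swapOp_mul_apply, swapOp_apply, Prod.swap_swap, Matrix.one_apply]

theorem transpose_swapOp : (swapOp d)ᵀ = swapOp d := by
  ext p q
  rw [Matrix.transpose_apply, swapOp_apply, swapOp_apply]
  exact if_congr (Prod.swap_eq_iff_eq_swap.trans eq_comm) rfl rfl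

theorem isHermitian_swapOp : (swapOp d).IsHermitian := by
  ext p q
  rw [Matrix.conjTranspose_apply, ← Matrix.transpose_apply (swapOp d), transpose_swapOp,
    swapOp_apply, apply_ite star, star_one, star_zero]

theorem one_add_smul_swapOp_posSemidef {s : ℝ} (hs : s ∈ ({1, -1} : Finset ℝ)) :
    (1 + s • swapOp d).PosSemidef := by
  have hsq : s ^ 2 = 1 := by
    rcases Finset.mem_insert.1 hs with rfl | hs
    · exact one_pow 2
    · rw [Finset.mem_singleton.1 hs, neg_one_sq]
  refine posSemidef_of_mul_self_eq_smul (c := 2) ?_ two_pos ?_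
  · exact Matrix.isHermitian_one.add (isHermitian_swapOp.smul (.all s))
  · simp only [mul_add, add_mul, one_mul, mul_one, smul_mul_smul_comm,
      swapOp_mul_swapOp, ← sq s, hsq]
    module

theorem swapChannel_apply (X : Matrix (Fin d × Fin d) (Fin d × Fin d) ℂ) (p q : Fin d × Fin d) :
    swapChannel d X p q = X p.swap q.swap := by
  have h : swapChannel d X = (swapOp d * (swapOp d * X)ᴴ)ᴴ := by
    rw [Matrix.conjTranspose_mul, Matrix.conjTranspose_conjTranspose]
    rfl
  rw [h, Matrix.conjTranspose_apply, swapOp_mul_apply, Matrix.conjTranspose_apply, star_star,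
    swapOp_mul_apply]

theorem choi_swapChannel :
    choi (swapChannel d) = splice (maxEnt (Fin d)) (maxEnt (Fin d)) := by
  ext ⟨⟨a, b⟩, ⟨a', b'⟩⟩ ⟨⟨i, j⟩, ⟨i', j'⟩⟩
  rw [choi_apply, swapChannel_apply]
  simp only [splice, maxEnt, Matrix.single_apply, Matrix.submatrix_apply,
    Matrix.kroneckerMap_apply, Matrix.of_apply, ite_zero_mul_ite_zero, mul_one, Prod.mk.injEq,
    Prod.swap_prod_mk]
  exact if_congr (by tauto) rfl rfl

theorem isPure_choi_swapChannel : IsPure (choi (swapChannel d)) :=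
  choi_swapChannel ▸ isPure_maxEnt.splice isPure_maxEnt

theorem isChannel_swapChannel : IsChannel (swapChannel d) := by
  refine ⟨isCP_iff_choi_posSemidef.2 isPure_choi_swapChannel.posSemidef, fun X => ?_⟩
  simp only [Matrix.trace, Matrix.diag_apply, swapChannel_apply]
  exact (Equiv.prodComm (Fin d) (Fin d)).sum_comp fun p => X p p

/-- The operator `d I - Γ`, a multiple of the projection onto the orthogonal complement of the
maximally entangled vector. -/
noncomputable def maxEntCompl (d : ℕ) : Matrix (Fin d × Fin d) (Fin d × Fin d) ℂ :=
  (d : ℝ) • 1 - maxEnt (Fin d)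

theorem maxEntCompl_posSemidef (hd : 1 ≤ d) : (maxEntCompl d).PosSemidef := by
  refine posSemidef_of_mul_self_eq_smul (c := d) ?_ (by positivity) ?_
  · exact (Matrix.isHermitian_one.smul (.all (d : ℝ))).sub isPure_maxEnt.posSemidef.isHermitian
  · simp only [maxEntCompl, mul_sub, sub_mul, smul_mul_assoc, mul_smul_comm, one_mul, mul_one,
      isPure_maxEnt.mul_self, trace_maxEnt, Fintype.card_fin]
    module

theorem traceSnd_maxEntCompl : traceSnd (maxEntCompl d) = ((d : ℝ) ^ 2 - 1) • 1 := by
  have hone : traceSnd (1 : Matrix (Fin d × Fin d) (Fin d × Fin d) ℂ) = (d : ℝ) • 1 := by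
    ext i j
    simp [traceSnd, Matrix.one_apply]
  have hadd := traceSnd_add (maxEntCompl d) (maxEnt (Fin d))
  rw [maxEntCompl, sub_add_cancel, traceSnd_smul, hone, traceSnd_maxEnt] at hadd
  rw [maxEntCompl, ← sub_eq_iff_eq_add.2 hadd]
  module

end SwapOperator

section ReducedSDP

/-- The operator whose partial transpose is constrained by the reduced program, with the constraints
indexed by signs `s` and `t`. It is the pairing of the twirled Choi operator with
`(1 + s F) ⊗ (1 + t F)`, up to a positive factor. -/
def swapSlack {V : Type*} [AddCommGroup V] [Module ℝ V] (d : ℕ) (s t : ℝ) (K L M N : V) : V :=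
  ((1 + s * d) * (1 + t * d)) • K + (1 + s * d) • L + (1 + t * d) • M + N

theorem map_swapSlack {m n : Type*} (f : Superop m n) (d : ℕ) (s t : ℝ) (K L M N : Matrix m m ℂ) :
    f (swapSlack d s t K L M N) = swapSlack d s t (f K) (f L) (f M) (f N) := by
  simp only [swapSlack, map_add, LinearMap.map_smul_of_tower]

variable {E G : Type*} [DecidableEq E] [DecidableEq G] {d : ℕ}

theorem swapFeasible_iff [Finite E] [Finite G] (hd : 2 ≤ d) {K L M N : Matrix (E × G) (E × G) ℂ} :
    SwapFeasible d K L M N ↔ (0 ≤ K ∧ 0 ≤ L ∧ 0 ≤ M ∧ 0 ≤ N) ∧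
      (∀ s ∈ ({1, -1} : Finset ℝ), ∀ t ∈ ({1, -1} : Finset ℝ),
        0 ≤ transposeSnd (swapSlack d s t K L M N)) ∧ K + L + M + N = 1 := by
  have := Fintype.ofFinite E
  have := Fintype.ofFinite G
  have hd2 : (2 : ℝ) ≤ d := by exact_mod_cast hd
  have hsub : (d : ℝ) - 1 ≠ 0 := by linarith
  have hadd : (d : ℝ) + 1 ≠ 0 := by linarith
  have h₁ : swapSlack d 1 1 K L M N = ((d : ℝ) + 1) ^ 2 • (K + (1 / (d + 1) : ℝ) • L +
      (1 / (d + 1) : ℝ) • M + (1 / (d + 1) ^ 2 : ℝ) • N) := by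
    rw [swapSlack]
    match_scalars <;> field_simp <;> ring
  have h₂ : swapSlack d 1 (-1) K L M N = (((d : ℝ) - 1) * (d + 1)) •
      ((1 / (d - 1) : ℝ) • (L + (1 / (d + 1) : ℝ) • N) - (K + (1 / (d + 1) : ℝ) • M)) := by
    rw [swapSlack]
    match_scalars <;> field_simp <;> ring
  have h₃ : swapSlack d (-1) 1 K L M N = (((d : ℝ) - 1) * (d + 1)) •
      ((1 / (d - 1) : ℝ) • (M + (1 / (d + 1) : ℝ) • N) - (K + (1 / (d + 1) : ℝ) • L)) := by
    rw [swapSlack]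
    match_scalars <;> field_simp <;> ring
  have h₄ : swapSlack d (-1) (-1) K L M N = ((d : ℝ) - 1) ^ 2 •
      ((K + (1 / (d - 1) ^ 2 : ℝ) • N) - (1 / (d - 1) : ℝ) • (L + M)) := by
    rw [swapSlack]
    match_scalars <;> field_simp <;> ring
  simp only [SwapFeasible, Finset.forall_mem_insert, Finset.mem_singleton, forall_eq, h₁, h₂, h₃,
    h₄, LinearMap.map_smul_of_tower, map_sub]
  rw [smul_nonneg_iff_nonneg_of_pos_left (by positivity),
    smul_nonneg_iff_nonneg_of_pos_left (mul_pos (by linarith) (by linarith)),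
    smul_nonneg_iff_nonneg_of_pos_left (mul_pos (by linarith) (by linarith)),
    smul_nonneg_iff_nonneg_of_pos_left (pow_pos (by linarith) 2), sub_nonneg, sub_nonneg,
    sub_nonneg]
  tauto

theorem sq_smul_splice_one_add_smul_maxEnt (s t : ℝ) :
    (d : ℝ) ^ 2 • splice (1 + s • maxEnt (Fin d)) (1 + t • maxEnt (Fin d)) =
      swapSlack d s t (splice (maxEnt (Fin d)) (maxEnt (Fin d)))
        (splice (maxEnt (Fin d)) (maxEntCompl d)) (splice (maxEntCompl d) (maxEnt (Fin d)))
        (splice (maxEntCompl d) (maxEntCompl d)) := by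
  ext p q
  simp only [swapSlack, splice, maxEntCompl, Matrix.submatrix_apply, Matrix.kroneckerMap_apply,
    Matrix.add_apply, Matrix.sub_apply, Matrix.smul_apply, Complex.real_smul]
  push_cast
  ring

theorem transposeSnd_one {A B : Type*} [DecidableEq A] [DecidableEq B] :
    transposeSnd (1 : Matrix (A × B) (A × B) ℂ) = 1 := by
  ext p q
  change (1 : Matrix (A × B) (A × B) ℂ) (p.1, q.2) (q.1, p.2) = _
  rw [Matrix.one_apply, Matrix.one_apply]
  exact if_congr (by rw [Prod.ext_iff, Prod.ext_iff, eq_comm (a := q.2)]) rfl rfl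

theorem transposeSnd_one_add_smul_maxEnt (s : ℝ) :
    transposeSnd (1 + s • maxEnt (Fin d)) = 1 + s • swapOp d := by
  rw [map_add, LinearMap.map_smul_of_tower, transposeSnd_one, transposeSnd_maxEnt]

theorem transposeSnd_maxEntCompl :
    transposeSnd (maxEntCompl d) = (d : ℝ) • 1 - swapOp d := by
  rw [maxEntCompl, map_sub, LinearMap.map_smul_of_tower, transposeSnd_one, transposeSnd_maxEnt]

end ReducedSDP

section SwapComponent

variable {E G : Type*} {d : ℕ}

/-- The operator on the resource `R` obtained by contracting an operator `P` on `A B R A' B'` with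
`x` on `A B'` and `y` on `B A'`. When `P` is the Choi operator of a channel, the normalization makes
the components for `x, y ∈ {Γ, d I - Γ}` sum to the identity. -/
noncomputable def swapComponent [Fintype E] [Fintype G]
    (P : Matrix (((Fin d × Fin d) × (E × G)) × (Fin d × Fin d))
      (((Fin d × Fin d) × (E × G)) × (Fin d × Fin d)) ℂ)
    (x y : Matrix (Fin d × Fin d) (Fin d × Fin d) ℂ) : Matrix (E × G) (E × G) ℂ :=
  ((d : ℝ) ^ 4)⁻¹ • contract P (splice x y)

variable [Fintype E] [Fintype G] {P : Matrix (((Fin d × Fin d) × (E × G)) × (Fin d × Fin d))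
  (((Fin d × Fin d) × (E × G)) × (Fin d × Fin d)) ℂ}

theorem swapSlack_swapComponent (s t : ℝ) :
    swapSlack d s t (swapComponent P (maxEnt (Fin d)) (maxEnt (Fin d)))
        (swapComponent P (maxEnt (Fin d)) (maxEntCompl d))
        (swapComponent P (maxEntCompl d) (maxEnt (Fin d)))
        (swapComponent P (maxEntCompl d) (maxEntCompl d)) =
      (d : ℝ) ^ 2 • swapComponent P (1 + s • maxEnt (Fin d)) (1 + t • maxEnt (Fin d)) := by
  have h := congrArg (fun W => ((d : ℝ) ^ 4)⁻¹ • contract P W)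
    (sq_smul_splice_one_add_smul_maxEnt (d := d) s t)
  simp only [map_swapSlack, LinearMap.map_smul_of_tower] at h
  simp only [swapSlack, swapComponent] at h ⊢
  rw [smul_comm ((d : ℝ) ^ 2), h]
  module

theorem swapComponent_nonneg (hP : 0 ≤ P) {x y : Matrix (Fin d × Fin d) (Fin d × Fin d) ℂ}
    (hx : x.PosSemidef) (hy : y.PosSemidef) : 0 ≤ swapComponent P x y :=
  ((contract_posSemidef (Matrix.nonneg_iff_posSemidef.1 hP)
    (splice_posSemidef hx hy)).smul (by positivity)).nonneg

theorem transposeSnd_swapComponent (x y : Matrix (Fin d × Fin d) (Fin d × Fin d) ℂ) :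
    transposeSnd (swapComponent P x y) =
      swapComponent (transposeBobChoi P) (transposeSnd x) (transposeSnd y)ᵀ := by
  rw [swapComponent, swapComponent, LinearMap.map_smul_of_tower, transposeSnd_contract_splice]

theorem swapComponent_one [DecidableEq E] [DecidableEq G] (hd : 1 ≤ d) (hP : traceSnd P = 1) :
    (d : ℝ) ^ 2 • swapComponent P 1 1 = 1 := by
  have hd0 : (d : ℝ) ≠ 0 := Nat.cast_ne_zero.2 (by lia)
  rw [swapComponent, splice_one, contract_one hP, Fintype.card_prod, Fintype.card_fin,
    smul_smul, smul_smul]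
  push_cast
  rw [show (d : ℝ) ^ 2 * ((d : ℝ) ^ 4)⁻¹ * (d * d) = 1 by field_simp, one_smul]

theorem swapFeasible_swapComponent [DecidableEq E] [DecidableEq G] (hd : 2 ≤ d) (hP : 0 ≤ P)
    (hPT : 0 ≤ transposeBobChoi P) (htrace : traceSnd P = 1) :
    SwapFeasible d (swapComponent P (maxEnt (Fin d)) (maxEnt (Fin d)))
      (swapComponent P (maxEnt (Fin d)) (maxEntCompl d))
      (swapComponent P (maxEntCompl d) (maxEnt (Fin d)))
      (swapComponent P (maxEntCompl d) (maxEntCompl d)) := by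
  have hΓ : (maxEnt (Fin d)).PosSemidef := isPure_maxEnt.posSemidef
  have hΓc : (maxEntCompl d).PosSemidef := maxEntCompl_posSemidef (by lia)
  refine (swapFeasible_iff hd).2 ⟨⟨swapComponent_nonneg hP hΓ hΓ, swapComponent_nonneg hP hΓ hΓc,
    swapComponent_nonneg hP hΓc hΓ, swapComponent_nonneg hP hΓc hΓc⟩, fun s hs t ht => ?_, ?_⟩
  · rw [swapSlack_swapComponent, LinearMap.map_smul_of_tower, transposeSnd_swapComponent,
      transposeSnd_one_add_smul_maxEnt, transposeSnd_one_add_smul_maxEnt]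
    exact smul_nonneg (by positivity) (swapComponent_nonneg hPT
      (one_add_smul_swapOp_posSemidef hs) (one_add_smul_swapOp_posSemidef ht).transpose)
  · have h := swapSlack_swapComponent (P := P) 0 0
    simp only [swapSlack, zero_mul, zero_smul, add_zero, mul_one, one_smul] at h
    rw [h, swapComponent_one (by lia) htrace]

theorem entFid_swapChannel_simulate [DecidableEq E] [DecidableEq G]
    (P : Superop ((Fin d × Fin d) × (E × G)) (Fin d × Fin d)) (ρ : Matrix (E × G) (E × G) ℂ) :
    entFid (swapChannel d) (simulate P ρ) =
      (ρ * swapComponent (choi P) (maxEnt (Fin d)) (maxEnt (Fin d))).trace.re := by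
  rw [swapComponent, Matrix.mul_smul, Matrix.trace_smul, trace_mul_contract, Complex.real_smul,
    Complex.re_ofReal_mul, ← choi_swapChannel, ← choi_simulate, entFid, Fintype.card_prod,
    Fintype.card_fin, div_eq_inv_mul]
  push_cast
  ring

end SwapComponent

section SwapChoi

variable {E G : Type*} {d : ℕ}

/-- The Choi operator of the C-PPT-P channel built from a feasible point of the reduced program: the
resource is measured with `K`, `L`, `M`, `N`, and the outcome tells which of the two transfers
`A → B'` and `B → A'` is the identity channel and which is the channel with Choi operator
proportional to `d I - Γ`. -/
noncomputable def swapChoi (d : ℕ) (K L M N : Matrix (E × G) (E × G) ℂ) :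
    Matrix (((Fin d × Fin d) × (E × G)) × (Fin d × Fin d))
      (((Fin d × Fin d) × (E × G)) × (Fin d × Fin d)) ℂ :=
  glue (splice (maxEnt (Fin d)) (maxEnt (Fin d))) K +
    ((d : ℝ) ^ 2 - 1)⁻¹ • glue (splice (maxEnt (Fin d)) (maxEntCompl d)) L +
    ((d : ℝ) ^ 2 - 1)⁻¹ • glue (splice (maxEntCompl d) (maxEnt (Fin d))) M +
    (((d : ℝ) ^ 2 - 1) ^ 2)⁻¹ • glue (splice (maxEntCompl d) (maxEntCompl d)) N

variable {K L M N : Matrix (E × G) (E × G) ℂ}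

theorem swapChoi_sub_glue_posSemidef [Finite E] [Finite G] (hd : 1 ≤ d) (hL : 0 ≤ L) (hM : 0 ≤ M)
    (hN : 0 ≤ N) :
    (swapChoi d K L M N - glue (splice (maxEnt (Fin d)) (maxEnt (Fin d))) K).PosSemidef := by
  have hΓ : (maxEnt (Fin d)).PosSemidef := isPure_maxEnt.posSemidef
  have hΓc : (maxEntCompl d).PosSemidef := maxEntCompl_posSemidef hd
  have hd1 : 0 ≤ (d : ℝ) ^ 2 - 1 := sub_nonneg.2 (one_le_pow₀ (by exact_mod_cast hd))
  rw [swapChoi, add_assoc, add_assoc, add_sub_cancel_left, ← add_assoc]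
  rw [Matrix.nonneg_iff_posSemidef] at hL hM hN
  exact (((glue_posSemidef (splice_posSemidef hΓ hΓc) hL).smul (inv_nonneg.2 hd1)).add
    ((glue_posSemidef (splice_posSemidef hΓc hΓ) hM).smul (inv_nonneg.2 hd1))).add
    ((glue_posSemidef (splice_posSemidef hΓc hΓc) hN).smul (by positivity))

theorem traceSnd_swapChoi [DecidableEq E] [DecidableEq G] (hd : 2 ≤ d) (h : K + L + M + N = 1) :
    traceSnd (swapChoi d K L M N) = 1 := by
  have hd2 : (2 : ℝ) ≤ d := by exact_mod_cast hd
  have hne : (d : ℝ) ^ 2 - 1 ≠ 0 := by nlinarith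
  have hsum : (1 : Matrix (Fin d × Fin d) (Fin d × Fin d) ℂ) ⊗ₖ (K + L + M + N)ᵀ = 1 := by
    rw [h, Matrix.transpose_one, Matrix.one_kronecker_one]
  rw [← hsum]
  simp only [swapChoi, traceSnd_add, traceSnd_smul, traceSnd_glue, traceSnd_splice,
    traceSnd_maxEnt, traceSnd_maxEntCompl, Matrix.kronecker_smul, Matrix.smul_kronecker,
    Matrix.one_kronecker_one, Matrix.transpose_add, Matrix.kronecker_add]
  match_scalars <;> field_simp

theorem transposeBobChoi_swapChoi (hd : 2 ≤ d) :
    transposeBobChoi (swapChoi d K L M N) =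
      ∑ s ∈ ({1, -1} : Finset ℝ), ∑ t ∈ ({1, -1} : Finset ℝ),
        ((d - s) * (d - t) / (4 * ((d : ℝ) ^ 2 - 1) ^ 2)) •
          glue (splice (1 + s • swapOp d) (1 + t • swapOp d))
            (transposeSnd (swapSlack d s t K L M N)) := by
  have hd2 : (2 : ℝ) ≤ d := by exact_mod_cast hd
  have hne : ((d : ℂ) ^ 2 - 1) ≠ 0 := by
    exact_mod_cast (show (d : ℝ) ^ 2 - 1 ≠ 0 by nlinarith)
  have hlhs : transposeBobChoi (swapChoi d K L M N) =
      glue (splice (transposeSnd (maxEnt (Fin d))) (transposeSnd (maxEnt (Fin d)))ᵀ)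
        (transposeSnd K) +
      ((d : ℝ) ^ 2 - 1)⁻¹ • glue (splice (transposeSnd (maxEnt (Fin d)))
        (transposeSnd (maxEntCompl d))ᵀ) (transposeSnd L) +
      ((d : ℝ) ^ 2 - 1)⁻¹ • glue (splice (transposeSnd (maxEntCompl d))
        (transposeSnd (maxEnt (Fin d)))ᵀ) (transposeSnd M) +
      (((d : ℝ) ^ 2 - 1) ^ 2)⁻¹ • glue (splice (transposeSnd (maxEntCompl d))
        (transposeSnd (maxEntCompl d))ᵀ) (transposeSnd N) := rfl
  rw [hlhs, Finset.sum_pair (by norm_num), Finset.sum_pair (by norm_num),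
    Finset.sum_pair (by norm_num), transposeSnd_maxEnt, transposeSnd_maxEntCompl,
    Matrix.transpose_sub, Matrix.transpose_smul, Matrix.transpose_one, transpose_swapOp]
  simp only [map_swapSlack]
  ext p q
  simp only [swapSlack, glue, splice, Matrix.submatrix_apply, Matrix.kroneckerMap_apply,
    Matrix.add_apply, Matrix.sub_apply, Matrix.smul_apply, Complex.real_smul,
    Matrix.transpose_apply]
  push_cast
  field_simp
  ring

theorem isCPPTP_ofChoi_swapChoi [Fintype E] [Fintype G] [DecidableEq E] [DecidableEq G]
    (hd : 2 ≤ d) (h : SwapFeasible d K L M N) : IsCPPTP (ofChoi (swapChoi d K L M N)) := by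
  obtain ⟨⟨hK, hL, hM, hN⟩, hT, hsum⟩ := (swapFeasible_iff hd).1 h
  have hd2 : (2 : ℝ) ≤ d := by exact_mod_cast hd
  rw [isCPPTP_iff, choi_ofChoi, transposeBobChoi_swapChoi hd]
  refine ⟨?_, Finset.sum_nonneg fun s hs => Finset.sum_nonneg fun t ht => ?_,
    traceSnd_swapChoi hd hsum⟩
  · have hΓ := (isPure_maxEnt (m := Fin d)).posSemidef
    exact (sub_add_cancel (swapChoi d K L M N) _ ▸
      (swapChoi_sub_glue_posSemidef (by lia) hL hM hN).add (glue_posSemidef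
        (splice_posSemidef hΓ hΓ) (Matrix.nonneg_iff_posSemidef.1 hK))).nonneg
  · have hle {r : ℝ} (hr : r ∈ ({1, -1} : Finset ℝ)) : 0 ≤ (d : ℝ) - r := by
      rcases Finset.mem_insert.1 hr with rfl | hr
      · linarith
      · linarith [Finset.mem_singleton.1 hr]
    exact smul_nonneg (div_nonneg (mul_nonneg (hle hs) (hle ht)) (by positivity))
      (glue_posSemidef (splice_posSemidef (one_add_smul_swapOp_posSemidef hs)
        (one_add_smul_swapOp_posSemidef ht))
        (Matrix.nonneg_iff_posSemidef.1 (hT s hs t ht))).nonneg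

theorem isCP_simulate_swapChoi_sub_smul [Fintype E] [Fintype G]
    (hd : 1 ≤ d) (hK : 0 ≤ K) (hL : 0 ≤ L) (hM : 0 ≤ M) (hN : 0 ≤ N)
    {ρ : Matrix (E × G) (E × G) ℂ} (hρ : ρ.PosSemidef) :
    IsCP (simulate (ofChoi (swapChoi d K L M N)) ρ - (ρ * K).trace.re • swapChannel d) := by
  classical
  have hreal : (ρ * K).trace = ((ρ * K).trace.re : ℂ) :=
    Complex.eq_re_of_ofReal_le (trace_mul_nonneg hρ (Matrix.nonneg_iff_posSemidef.1 hK))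
  have hR : IsCP (simulate
      (ofChoi (swapChoi d K L M N - glue (splice (maxEnt (Fin d)) (maxEnt (Fin d))) K)) ρ) := by
    refine IsCP.simulate (isCP_iff_choi_posSemidef.2 ?_) hρ
    rw [choi_ofChoi]
    exact swapChoi_sub_glue_posSemidef hd hL hM hN
  rw [isCP_iff_choi_posSemidef, choi_simulate, choi_ofChoi, contractResource_sub,
    contractResource_glue, hreal, ← choi_swapChannel] at hR
  rw [isCP_iff_choi_posSemidef]
  change (choi (simulate (ofChoi (swapChoi d K L M N)) ρ) -
    (ρ * K).trace.re • choi (swapChannel d)).PosSemidef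
  rwa [choi_simulate, choi_ofChoi]

end SwapChoi

section SwapProgram

variable {E G : Type*} [Fintype E] [Fintype G] [DecidableEq E] [DecidableEq G] {d : ℕ}
  {ρ : Matrix (E × G) (E × G) ℂ}

theorem exists_swapFeasible_of_mem_simulationEntFids (hd : 2 ≤ d) {f : ℝ}
    (hf : f ∈ simulationEntFids (swapChannel d) ρ) :
    ∃ K L M N, SwapFeasible d K L M N ∧ f = (ρ * K).trace.re := by
  obtain ⟨P, hP, rfl⟩ := hf
  obtain ⟨hP0, hPT, htrace⟩ := isCPPTP_iff.1 hP
  exact ⟨_, _, _, _, swapFeasible_swapComponent hd hP0 hPT htrace, entFid_swapChannel_simulate P ρ⟩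

theorem exists_isCPPTP_of_swapFeasible (hd : 2 ≤ d) (hρ : ρ.PosSemidef)
    {K L M N : Matrix (E × G) (E × G) ℂ} (h : SwapFeasible d K L M N) :
    ∃ P, IsCPPTP P ∧ IsCP (simulate P ρ - (ρ * K).trace.re • swapChannel d) := by
  obtain ⟨⟨hK, hL, hM, hN⟩, -⟩ := (swapFeasible_iff hd).1 h
  exact ⟨_, isCPPTP_ofChoi_swapChoi hd h,
    isCP_simulate_swapChoi_sub_smul (by lia) hK hL hM hN hρ⟩

omit [DecidableEq E] [DecidableEq G] in
theorem isTwirlable_swapChannel (hd : 1 ≤ d) (hρ : IsState ρ) :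
    IsTwirlable (swapChannel d) ρ := by
  classical
  obtain rfl | hd2 := hd.eq_or_lt
  · exact isTwirlable_of_subsingleton isChannel_swapChannel isPure_choi_swapChannel hρ
  · intro f hf
    obtain ⟨K, L, M, N, h, rfl⟩ := exists_swapFeasible_of_mem_simulationEntFids hd2 hf
    exact exists_isCPPTP_of_swapFeasible hd2 hρ.1 h

theorem swapReducedSDP_eq (hd : 2 ≤ d) (hρ : IsState ρ) :
    swapReducedSDP d ρ = 1 - sSup (simulationEntFids (swapChannel d) ρ) := by
  have : NeZero d := ⟨by lia⟩
  refine congrArg (1 - ·) (csSup_eq_csSup_of_forall_exists_le ?_ ?_)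
  · rintro x ⟨K, L, M, N, h, rfl⟩
    obtain ⟨P, hP, hPx⟩ := exists_isCPPTP_of_swapFeasible hd hρ.1 h
    exact ⟨_, ⟨P, hP, rfl⟩, le_entFid_of_isCP_sub_smul isChannel_swapChannel
      isPure_choi_swapChannel hPx⟩
  · intro f hf
    exact ⟨f, exists_swapFeasible_of_mem_simulationEntFids hd hf, le_rfl⟩

end SwapProgram

end BQT

theorem mainTheorem8 {E G : Type*} [Fintype E] [Fintype G] [DecidableEq E] [DecidableEq G]
    (d : ℕ) (hd : 1 ≤ d) (ρ : Matrix (E × G) (E × G) ℂ) (hρ : BQT.IsState ρ) :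
    BQT.errPPTInfid (BQT.swapChannel d) ρ = BQT.errPPT (BQT.swapChannel d) ρ ∧
    BQT.infidSDP (BQT.swapChannel d) ρ = BQT.errPPTInfid (BQT.swapChannel d) ρ ∧
    (2 ≤ d →
      BQT.errPPTInfid (BQT.swapChannel d) ρ = BQT.swapReducedSDP d ρ ∧
      BQT.errPPT (BQT.swapChannel d) ρ = BQT.swapReducedSDP d ρ) := by
  have : NeZero d := ⟨by lia⟩
  have htwirl := BQT.isTwirlable_swapChannel hd hρ
  rw [htwirl.errPPTInfid_eq BQT.isChannel_swapChannel BQT.isPure_choi_swapChannel hρ,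
    htwirl.errPPT_eq BQT.isChannel_swapChannel BQT.isPure_choi_swapChannel hρ,
    htwirl.infidSDP_eq BQT.isChannel_swapChannel BQT.isPure_choi_swapChannel hρ]
  refine ⟨rfl, rfl, fun hd2 => ?_⟩
  rw [BQT.swapReducedSDP_eq hd2 hρ]
  exact ⟨rfl, rfl⟩
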